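/- **Setting.** Let $n,d\ge 1$, let $x_1,\dots,x_n\in\mathbb{R}^d$ be inputs with $\|x_i\|_2=1$ that are pairwise non-parallel ($x_i$ and $x_j$ are linearly independent for $i\ne j$), and let $y\in\mathbb{R}^n$ be labels with $|y_i|\le B$. Consider the two-layer ReLU network with $m$ hidden units $$f(w,a,x)=\frac1{\sqrt m}\sum_{r=1}^m a_r\,\phi(w_r^\top x),\qquad \phi(z)=\max(z,0),$$ where $w=(w_1,\dots,w_m)$, $w_r\in\mathbb{R}^d$, and $a\in\mathbb{R}^m$. Write $u(w)=(f(w,a,x_i))_{i=1}^n$, let $J(w)\in\mathbb{R}^{n\times md}$ be the Jacobian of $u$ with respect to $w$, whose $i$-th row has $r$-th block $\frac{1}{\sqrt m}a_r\mathbb{I}\{w_r^\top x_i\ge 0\}\,x_i^\top$, and put $G(w)=J(w)J(w)^\top$. At initialization all $w_r(0)\sim\mathcal N(0,\nu^2 I)$ and all $a_r\sim\mathrm{unif}\{-1,+1\}$ are independent. Exact natural gradient descent with step size $\eta$ trains the first layer only ($a$ stays fixed): $$w(k+1)=w(k)-\eta\,J(w(k))^\top G(w(k))^{-1}\bigl(u(k)-y\bigr),\qquad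 u(k)=u(w(k)).$$ Let $G^\infty\in\mathbb{R}^{n\times n}$ be the limiting Gram matrix, $G^\infty_{ij}=\mathbb{E}_{w\sim\mathcal N(0,\nu^2I)}\bigl[x_i^\top x_j\,\mathbb{I}\{w^\top x_i\ge0,\ w^\top x_j\ge0\}\bigr]$, and let $\lambda_0=\lambda_{\min}(G^\infty)$ be its smallest eigenvalue. **Theorem (Natural Gradient Descent for overparameterized Networks).** For all real constants $B$, $N$ and $\eta_0\in(0,1)$ there is a constant $K>0$, depending only on $B$, $N$, $\eta_0$, such that for all $n,d$ and all data as above, all $0<\nu\le N$ and all $\delta\in(0,1)$, we have $\lambda_0>0$ and the following holds. If $$m\ \ge\ K\,\frac{n^4}{\nu^2\lambda_0^4\delta^3}\qquad\text{and}\qquad 0<\eta\le\eta_0,$$ then with probability at least $1-\delta$ over the random initialization, for every $k=0,1,2,\dots$ the matrix $G(w(k))$ is invertible (so the iteration is well defined) and $$\|u(k)-y\|_2^2\ \le\ (1-\eta)^k\,\|u(0)-y\|_2^2 .$$ -/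

import Mathlib

open MeasureTheory ProbabilityTheory
open scoped Matrix

namespace NGD

/-- First-layer weights `w = (w_1, …, w_m)` of a network with `m` hidden units and inputs in
`ℝ^d`. -/
abbrev Weights (m d : ℕ) : Type := Fin m → EuclideanSpace ℝ (Fin d)

/-- The ReLU activation function. -/
noncomputable def relu (z : ℝ) : ℝ := max z 0

/-- The derivative of the ReLU, `𝕀 {z ≥ 0}`, with value `1` at the kink `z = 0`. -/
noncomputable def reluDeriv (z : ℝ) : ℝ := if 0 ≤ z then 1 else 0

/-- The two-layer network `f(w, a, x) = (1 / √m) ∑ r, a_r φ(w_rᵀ x)`. -/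
noncomputable def network {m d : ℕ} (w : Weights m d) (a : Fin m → ℝ)
    (x : EuclideanSpace ℝ (Fin d)) : ℝ :=
  (1 / Real.sqrt m) * ∑ r, a r * relu (inner ℝ (w r) x)

/-- The vector `u = (f(w, a, x_1), …, f(w, a, x_n))` of network outputs on the training inputs. -/
noncomputable def outputs {n m d : ℕ} (x : Fin n → EuclideanSpace ℝ (Fin d)) (a : Fin m → ℝ)
    (w : Weights m d) : Fin n → ℝ :=
  fun i => network w a (x i)

/-- The `n × md` Jacobian matrix `J` of the outputs with respect to the first-layer weights.
The entry in row `i` and column `(r, j)` is the partial derivative of `f(w, a, x_i)` with respect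
to the `j`-th coordinate of `w_r`. -/
noncomputable def jacobian {n m d : ℕ} (x : Fin n → EuclideanSpace ℝ (Fin d)) (a : Fin m → ℝ)
    (w : Weights m d) : Matrix (Fin n) (Fin m × Fin d) ℝ :=
  Matrix.of fun i p =>
    (1 / Real.sqrt m) * a p.1 * reluDeriv (inner ℝ (w p.1) (x i)) * x i p.2

/-- The Gram matrix `G = J Jᵀ`. -/
noncomputable def gram {n m d : ℕ} (x : Fin n → EuclideanSpace ℝ (Fin d)) (a : Fin m → ℝ)
    (w : Weights m d) : Matrix (Fin n) (Fin n) ℝ :=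
  jacobian x a w * (jacobian x a w)ᵀ

/-- One step of exact natural gradient descent on the first layer,
`w ↦ w - η Jᵀ (J Jᵀ)⁻¹ (u - y)`. -/
noncomputable def ngdStep {n m d : ℕ} (x : Fin n → EuclideanSpace ℝ (Fin d)) (y : Fin n → ℝ)
    (η : ℝ) (a : Fin m → ℝ) (w : Weights m d) : Weights m d :=
  fun r => WithLp.toLp 2 fun j =>
    w r j - η * ((jacobian x a w)ᵀ *ᵥ ((gram x a w)⁻¹ *ᵥ (outputs x a w - y))) (r, j)

/-- The iterates `w(k)` of natural gradient descent started at `w₀`; the output weights `a` stay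
fixed. -/
noncomputable def ngdIterate {n m d : ℕ} (x : Fin n → EuclideanSpace ℝ (Fin d)) (y : Fin n → ℝ)
    (η : ℝ) (a : Fin m → ℝ) (w₀ : Weights m d) : ℕ → Weights m d
  | 0 => w₀
  | k + 1 => ngdStep x y η a (ngdIterate x y η a w₀ k)

/-- The Gaussian law `𝓝(0, ν² I)` on `ℝ^d`. -/
noncomputable def weightLaw (d : ℕ) (ν : ℝ) : Measure (EuclideanSpace ℝ (Fin d)) :=
  multivariateGaussian 0 (ν ^ 2 • (1 : Matrix (Fin d) (Fin d) ℝ))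

/-- The uniform law on `{-1, +1}`. -/
noncomputable def signLaw : Measure ℝ := uniformOn ({-1, 1} : Set ℝ)

instance (d : ℕ) (ν : ℝ) : IsProbabilityMeasure (weightLaw d ν) := by
  unfold weightLaw; infer_instance

instance : IsProbabilityMeasure signLaw :=
  isProbabilityMeasure_uniformOn (Set.toFinite _) (Set.insert_nonempty _ _)

/-- The law of the random initialization `(w, a)`: all `w_r ∼ 𝓝(0, ν² I)` and all
`a_r ∼ unif {-1, +1}` are independent. -/
noncomputable def initLaw (m d : ℕ) (ν : ℝ) : Measure (Weights m d × (Fin m → ℝ)) :=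
  (Measure.pi fun _ : Fin m => weightLaw d ν).prod (Measure.pi fun _ : Fin m => signLaw)

/-- The limiting Gram matrix
`G^∞_ij = 𝔼_{w ∼ 𝓝(0, ν² I)} [x_iᵀ x_j 𝕀 {wᵀ x_i ≥ 0, wᵀ x_j ≥ 0}]`. -/
noncomputable def limitGram {n d : ℕ} (x : Fin n → EuclideanSpace ℝ (Fin d)) (ν : ℝ) :
    Matrix (Fin n) (Fin n) ℝ :=
  Matrix.of fun i j =>
    ∫ w, Set.indicator {w | 0 ≤ inner ℝ w (x i) ∧ 0 ≤ inner ℝ w (x j)}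
      (fun _ => inner ℝ (x i) (x j)) w ∂(weightLaw d ν)

/-- The smallest eigenvalue of a real symmetric matrix of positive size. -/
noncomputable def lambdaMin {n : ℕ} (A : Matrix (Fin n) (Fin n) ℝ) : ℝ := sInf (spectrum ℝ A)

/-- `λ₀ = λ_min(G^∞)`. -/
noncomputable def lambdaZero {n d : ℕ} (x : Fin n → EuclideanSpace ℝ (Fin d)) (ν : ℝ) : ℝ :=
  lambdaMin (limitGram x ν)

end NGD

/-!
Natural gradient descent acts on the outputs as gradient descent with the identity as kernel: since
`J Jᵀ G⁻¹ = 1`, a step multiplies the residual `u - y` by `1 - η`, up to the error of linearizing the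
network. A ReLU agrees with its linearization unless its argument changes sign, so both this error
and the change of the Jacobian are controlled by the number of hidden units whose activation pattern
flips (`norm_outputs_linearization_sq_le`, `sum_sq_jacobian_sub`).

A unit flips on an input only if its pre-activation starts within `t` of zero or its weight moves by
at least `t` (`card_flips_le`). The Gaussian density bounds the expected number of the former by
`m t / ν`; if the weights move by at most `R` in total, there are at most `R² / t²` of the latter.
With `ε = (1 - η₀)² / 512`, the choice `t = ε λ₀ ν δ / n` makes the proportion of flips, summed over
the inputs, at most `4 ε λ₀` as soon as `m` is of order `n⁴ / (ν² λ₀⁴ δ³)`, where `R² = O(n / (δ λ₀))`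
is a multiple of the squared initial residual divided by `λ₀`. As long as the iterates stay within `R` of the
initialization, the Gram matrix therefore keeps its spectrum above `λ₀ / 16` and the residual shrinks
by the factor `q = 1 - η (1 + η₀) / 2`, with `q² ≤ 1 - η`; the steps then form a geometric series
with sum at most `R`, so the iterates never leave the ball (`ngdIterate_converges`).

At the initialization, Markov's inequality applied to three moments (`lintegral_outputs_sq_le`,
`lintegral_unitGram_average_sq_le`, `lintegral_card_nearKink_le`) gives a bounded residual, a Gram
matrix with spectrum above `λ₀ / 2`, and few units near a kink, each with failure probability `δ / 3`.

Positivity of `λ₀` is the linear independence of the features `w ↦ 𝕀 {wᵀ x_i ≥ 0} x_i`, which holds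
because the `i`-th one jumps across a piece of the hyperplane orthogonal to `x_i` on which all others
are continuous, and the Gaussian law charges both sides (`eq_zero_of_feature_ae_eq_zero`).
-/

namespace NGD

/-! ### The Gaussian initialization -/

lemma map_inner_weightLaw {d : ℕ} {ν : ℝ} {x : EuclideanSpace ℝ (Fin d)} (hx : ‖x‖ = 1) :
    (weightLaw d ν).map (fun w => inner ℝ w x) = gaussianReal 0 (ν ^ 2).toNNReal := by
  have hS : (ν ^ 2 • (1 : Matrix (Fin d) (Fin d) ℝ)).PosSemidef :=
    Matrix.PosSemidef.one.smul (sq_nonneg ν)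
  have hf : (fun w : EuclideanSpace ℝ (Fin d) => inner ℝ w x) = innerSL ℝ x := by
    ext w; simp [real_inner_comm]
  have : IsGaussian (weightLaw d ν) := by unfold weightLaw; infer_instance
  have hmean : ∫ w, innerSL ℝ x w ∂(weightLaw d ν) = 0 := by
    have h := (innerSL ℝ x).integral_comp_comm (IsGaussian.integrable_id (μ := weightLaw d ν))
    simp only [id_eq] at h
    rw [h, weightLaw, integral_id_multivariateGaussian, map_zero]
  rw [hf, IsGaussian.map_eq_gaussianReal, hmean, ← covariance_self (by fun_prop)]
  have h1 : covarianceBilin (weightLaw d ν) x x = ν ^ 2 := by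
    unfold weightLaw
    rw [covarianceBilin_multivariateGaussian hS, Matrix.smul_mulVec, Matrix.one_mulVec,
      dotProduct_smul, smul_eq_mul]
    have : x.ofLp ⬝ᵥ x.ofLp = ‖x‖ ^ 2 := by
      rw [EuclideanSpace.real_norm_sq_eq]; simp [dotProduct, sq]
    rw [this, hx]; simp
  rw [covarianceBilin_apply_eq_cov IsGaussian.memLp_two_id] at h1
  have h2 : (fun u : EuclideanSpace ℝ (Fin d) => inner ℝ x u) = innerSL ℝ x := by
    ext w; simp
  rw [h2] at h1
  rw [h1]

lemma gaussianReal_abs_le {ν t : ℝ} (hν : 0 < ν) :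
    gaussianReal 0 (ν ^ 2).toNNReal {z | |z| ≤ t} ≤ ENNReal.ofReal (t / ν) := by
  have hv : (ν ^ 2).toNNReal ≠ 0 := by simp [hν.ne']
  have hset : {z : ℝ | |z| ≤ t} = Set.Icc (-t) t := by ext z; simp [abs_le]
  rw [gaussianReal_apply 0 hv, hset]
  have hb : ∀ z : ℝ, gaussianPDF 0 (ν ^ 2).toNNReal z ≤ ENNReal.ofReal (1 / (2 * ν)) := by
    intro z
    refine ENNReal.ofReal_le_ofReal ?_
    rw [gaussianPDFReal, Real.coe_toNNReal _ (sq_nonneg ν)]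
    have h1 : Real.exp (-(z - 0) ^ 2 / (2 * ν ^ 2)) ≤ 1 := by
      rw [Real.exp_le_one_iff]
      exact div_nonpos_of_nonpos_of_nonneg (by nlinarith [sq_nonneg (z - 0)]) (by positivity)
    have h2 : 2 * ν ≤ √(2 * Real.pi * ν ^ 2) := by
      apply Real.le_sqrt_of_sq_le
      nlinarith [Real.pi_gt_three, sq_pos_of_pos hν]
    calc (√(2 * Real.pi * ν ^ 2))⁻¹ * Real.exp (-(z - 0) ^ 2 / (2 * ν ^ 2))
        ≤ (√(2 * Real.pi * ν ^ 2))⁻¹ * 1 := by gcongr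
      _ ≤ 1 / (2 * ν) := by
        rw [mul_one, one_div]
        exact inv_anti₀ (by positivity) h2
  calc ∫⁻ z in Set.Icc (-t) t, gaussianPDF 0 (ν ^ 2).toNNReal z
      ≤ ∫⁻ _ in Set.Icc (-t) t, ENNReal.ofReal (1 / (2 * ν)) := lintegral_mono hb
    _ = ENNReal.ofReal (t / ν) := by
      rw [setLIntegral_const, Real.volume_Icc, ← ENNReal.ofReal_mul (by positivity)]
      congr 1
      field_simp
      ring

/-- Anti-concentration: a pre-activation on a unit input has density at most `1 / (2 ν)`. -/
lemma weightLaw_abs_inner_le {d : ℕ} {ν t : ℝ} (hν : 0 < ν)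
    {x : EuclideanSpace ℝ (Fin d)} (hx : ‖x‖ = 1) :
    weightLaw d ν {w | |inner ℝ w x| ≤ t} ≤ ENNReal.ofReal (t / ν) := by
  have h := gaussianReal_abs_le (t := t) hν
  rwa [← map_inner_weightLaw hx, Measure.map_apply (by fun_prop)
    (measurableSet_le (by fun_prop) (by fun_prop))] at h

lemma lintegral_inner_sq_weightLaw {d : ℕ} {ν : ℝ}
    {x : EuclideanSpace ℝ (Fin d)} (hx : ‖x‖ = 1) :
    ∫⁻ w, ENNReal.ofReal ((inner ℝ w x) ^ 2) ∂(weightLaw d ν) = ENNReal.ofReal (ν ^ 2) := by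
  have h : ∫⁻ z, ENNReal.ofReal (z ^ 2) ∂(gaussianReal 0 (ν ^ 2).toNNReal)
      = ENNReal.ofReal (ν ^ 2) := by
    have hL : MemLp (fun z : ℝ => z) 2 (gaussianReal 0 (ν ^ 2).toNNReal) :=
      memLp_id_gaussianReal' 2 (by simp)
    rw [← ofReal_integral_eq_lintegral_ofReal hL.integrable_sq
      (Filter.Eventually.of_forall fun z => sq_nonneg z)]
    have := variance_fun_id_gaussianReal (μ := 0) (v := (ν ^ 2).toNNReal)
    rw [variance_eq_integral (by fun_prop)] at this
    simp only [integral_id_gaussianReal, sub_zero] at this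
    rw [this, Real.coe_toNNReal _ (sq_nonneg ν)]
  rwa [← map_inner_weightLaw hx, lintegral_map (by fun_prop) (by fun_prop)] at h

instance isOpenPosMeasure_gaussianReal_zero_one : (gaussianReal 0 1).IsOpenPosMeasure :=
  (gaussianReal_absolutelyContinuous' 0 one_ne_zero).isOpenPosMeasure

open scoped MatrixOrder in
/-- The Gaussian law `𝓝(0, ν² I)` with `ν > 0` charges every nonempty open set. -/
lemma isOpenPosMeasure_weightLaw {d : ℕ} {ν : ℝ} (hν : 0 < ν) :
    (weightLaw d ν).IsOpenPosMeasure := by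
  have hsqrt : CFC.sqrt (ν ^ 2 • (1 : Matrix (Fin d) (Fin d) ℝ)) = ν • 1 := by
    have hnn : (0 : Matrix (Fin d) (Fin d) ℝ) ≤ ν • 1 :=
      (Matrix.PosSemidef.one.smul hν.le).nonneg
    have h := CFC.sqrt_mul_self (ν • (1 : Matrix (Fin d) (Fin d) ℝ)) hnn
    rw [← h]; congr 1
    simp [sq, smul_smul]
  unfold weightLaw multivariateGaussian
  rw [hsqrt, ← map_pi_eq_stdGaussian, Measure.map_map (by fun_prop) (by fun_prop)]
  refine Continuous.isOpenPosMeasure_map (by fun_prop) ?_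
  intro y
  refine ⟨ν⁻¹ • y.ofLp, ?_⟩
  ext i
  simp [hν.ne']

/-! ### Positive definiteness of the limiting Gram matrix -/

lemma reluDeriv_of_pos {z : ℝ} (hz : 0 < z) : reluDeriv z = 1 := by simp [reluDeriv, hz.le]

lemma reluDeriv_of_neg {z : ℝ} (hz : z < 0) : reluDeriv z = 0 := by simp [reluDeriv, hz]

lemma reluDeriv_eq_zero_or_one (z : ℝ) : reluDeriv z = 0 ∨ reluDeriv z = 1 := by
  unfold reluDeriv; split_ifs <;> simp

@[fun_prop]
lemma measurable_reluDeriv : Measurable reluDeriv :=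
  Measurable.ite (measurableSet_le measurable_const measurable_id) measurable_const measurable_const

/-- The gradient feature `∑ i, v_i 𝕀 {wᵀ x_i ≥ 0} x_i` of a single hidden unit with weight `w`, in
the direction `v` of output space. -/
noncomputable def feature {n d : ℕ} (x : Fin n → EuclideanSpace ℝ (Fin d)) (v : Fin n → ℝ)
    (w : EuclideanSpace ℝ (Fin d)) : EuclideanSpace ℝ (Fin d) :=
  ∑ i, (v i * reluDeriv (inner ℝ w (x i))) • x i

/-- The integrand of the limiting Gram matrix: the contribution of one hidden unit. -/
noncomputable def unitGram {n d : ℕ} (x : Fin n → EuclideanSpace ℝ (Fin d)) (i j : Fin n)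
    (w : EuclideanSpace ℝ (Fin d)) : ℝ :=
  reluDeriv (inner ℝ w (x i)) * reluDeriv (inner ℝ w (x j)) * inner ℝ (x i) (x j)

@[fun_prop]
lemma measurable_unitGram {n d : ℕ} (x : Fin n → EuclideanSpace ℝ (Fin d)) (i j : Fin n) :
    Measurable (unitGram x i j) := by
  unfold unitGram; fun_prop

lemma abs_unitGram_le {n d : ℕ} {x : Fin n → EuclideanSpace ℝ (Fin d)} (hx : ∀ i, ‖x i‖ = 1)
    (i j : Fin n) (w : EuclideanSpace ℝ (Fin d)) : |unitGram x i j w| ≤ 1 := by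
  have h := abs_real_inner_le_norm (x i) (x j)
  rw [hx, hx, one_mul] at h
  unfold unitGram
  rcases reluDeriv_eq_zero_or_one (inner ℝ w (x i)) with h1 | h1 <;>
  rcases reluDeriv_eq_zero_or_one (inner ℝ w (x j)) with h2 | h2 <;> simp [h1, h2, h]

lemma memLp_unitGram {n d : ℕ} {x : Fin n → EuclideanSpace ℝ (Fin d)} (hx : ∀ i, ‖x i‖ = 1)
    (i j : Fin n) (ν : ℝ) : MemLp (unitGram x i j) 2 (weightLaw d ν) :=
  MemLp.of_bound (by fun_prop) 1 (Filter.Eventually.of_forall (abs_unitGram_le hx i j))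

lemma limitGram_apply {n d : ℕ} (x : Fin n → EuclideanSpace ℝ (Fin d)) (ν : ℝ) (i j : Fin n) :
    limitGram x ν i j = ∫ w, unitGram x i j w ∂(weightLaw d ν) := by
  rw [limitGram, Matrix.of_apply]
  refine integral_congr_ae (Filter.Eventually.of_forall fun w => ?_)
  by_cases h1 : 0 ≤ inner ℝ w (x i) <;> by_cases h2 : 0 ≤ inner ℝ w (x j) <;>
    simp [unitGram, reluDeriv, Set.indicator, h1, h2]

lemma limitGram_isHermitian {n d : ℕ} (x : Fin n → EuclideanSpace ℝ (Fin d)) (ν : ℝ) :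
    (limitGram x ν).IsHermitian := by
  ext i j
  simp only [Matrix.conjTranspose_apply, limitGram_apply, star_trivial]
  refine integral_congr_ae (Filter.Eventually.of_forall fun w => ?_)
  simp only [unitGram, real_inner_comm (x i) (x j)]
  ring

lemma norm_feature_sq {n d : ℕ} (x : Fin n → EuclideanSpace ℝ (Fin d)) (v : Fin n → ℝ)
    (w : EuclideanSpace ℝ (Fin d)) :
    ‖feature x v w‖ ^ 2 = ∑ i, ∑ j, v i * (v j * unitGram x i j w) := by
  rw [← real_inner_self_eq_norm_sq, feature, sum_inner]
  simp_rw [inner_sum, real_inner_smul_left, real_inner_smul_right]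
  refine Finset.sum_congr rfl fun i _ => Finset.sum_congr rfl fun j _ => ?_
  rw [unitGram]; ring

lemma limitGram_quadratic {n d : ℕ} {x : Fin n → EuclideanSpace ℝ (Fin d)}
    (hx : ∀ i, ‖x i‖ = 1) (v : Fin n → ℝ) (ν : ℝ) :
    Integrable (fun w => ‖feature x v w‖ ^ 2) (weightLaw d ν) ∧
    v ⬝ᵥ limitGram x ν *ᵥ v = ∫ w, ‖feature x v w‖ ^ 2 ∂(weightLaw d ν) := by
  have hint : ∀ i j, Integrable (fun w => v i * (v j * unitGram x i j w)) (weightLaw d ν) :=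
    fun i j => (((memLp_unitGram hx i j ν).integrable one_le_two).const_mul _).const_mul _
  simp_rw [norm_feature_sq]
  refine ⟨integrable_finsetSum _ fun i _ => integrable_finsetSum _ fun j _ => hint i j, ?_⟩
  rw [integral_finsetSum _ fun i _ => integrable_finsetSum _ fun j _ => hint i j]
  simp_rw [integral_finsetSum _ fun j _ => hint _ j, integral_const_mul, ← limitGram_apply]
  simp only [dotProduct, Matrix.mulVec, Finset.mul_sum]
  refine Finset.sum_congr rfl fun i _ => Finset.sum_congr rfl fun j _ => ?_
  ring

/-- For pairwise non-parallel inputs, some point of the hyperplane orthogonal to `x i` avoids the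
hyperplanes orthogonal to all other inputs. -/
lemma exists_inner_eq_zero_forall_ne {n d : ℕ} {x : Fin n → EuclideanSpace ℝ (Fin d)}
    (hx : ∀ i, ‖x i‖ = 1) (hli : ∀ i j, i ≠ j → LinearIndependent ℝ ![x i, x j]) (i : Fin n) :
    ∃ z : EuclideanSpace ℝ (Fin d), inner ℝ z (x i) = 0 ∧ ∀ j, j ≠ i → inner ℝ z (x j) ≠ 0 := by
  have hself : ∀ k, inner ℝ (x k) (x k) = (1 : ℝ) := fun k => by
    rw [real_inner_self_eq_norm_sq, hx, one_pow]
  obtain ⟨z, hz, hz'⟩ := Module.Dual.exists_forall_mem_ne_zero_of_forall_exists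
    (LinearMap.ker (innerₛₗ ℝ (x i))) (fun j : {j // j ≠ i} => innerₛₗ ℝ (x j)) (by
      rintro ⟨j, hj⟩
      set c : ℝ := inner ℝ (x i) (x j) with hc
      refine ⟨x j - c • x i, ?_, ?_⟩
      · simp [inner_sub_right, real_inner_smul_right, ← hc, hx]
      · intro h0
        have hc' : inner ℝ (x j) (x i) = c := by rw [hc, real_inner_comm]
        have h1 : 1 - c * c = 0 := by
          simpa [inner_sub_right, real_inner_smul_right, hself, hc', hx] using h0
        have h2 : ‖x j - c • x i‖ ^ 2 = 0 := by
          rw [← real_inner_self_eq_norm_sq]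
          simp only [inner_sub_right, inner_sub_left, real_inner_smul_right, real_inner_smul_left,
            hself, hc', ← hc]
          linarith
        have h3 : x j - c • x i = 0 := by simpa using h2
        have h4 := (LinearIndependent.pair_iff.1 (hli i j (Ne.symm hj))) c (-1) (by
          rw [sub_eq_zero] at h3
          rw [h3]; simp)
        norm_num at h4)
  refine ⟨z, ?_, fun j hj => ?_⟩
  · rw [real_inner_comm]; simpa using hz
  · rw [real_inner_comm]; simpa using hz' ⟨j, hj⟩

/-- Crossing the hyperplane orthogonal to `x i` at a point off all other hyperplanes changes the
gradient feature by exactly `v i • x i`; hence a feature that vanishes almost everywhere has zero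
coefficients. -/
lemma eq_zero_of_feature_ae_eq_zero {n d : ℕ} {x : Fin n → EuclideanSpace ℝ (Fin d)}
    (hx : ∀ i, ‖x i‖ = 1) (hli : ∀ i j, i ≠ j → LinearIndependent ℝ ![x i, x j])
    (μ : Measure (EuclideanSpace ℝ (Fin d))) [μ.IsOpenPosMeasure] {v : Fin n → ℝ}
    (h : ∀ᵐ w ∂μ, feature x v w = 0) : v = 0 := by
  funext i
  obtain ⟨z, hz, hz'⟩ := exists_inner_eq_zero_forall_ne hx hli i
  -- the cell of the other hyperplanes around `z`
  set U : Set (EuclideanSpace ℝ (Fin d)) :=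
    ⋂ j ∈ {j | j ≠ i}, {w | 0 < inner ℝ w (x j) * inner ℝ z (x j)} with hU
  have hUo : IsOpen U := by
    refine (Set.toFinite _).isOpen_biInter fun j _ => ?_
    exact isOpen_lt continuous_const (by fun_prop)
  have hzU : z ∈ U := by
    simp only [hU, Set.mem_iInter]
    intro j hj
    exact mul_self_pos.2 (hz' j hj)
  have hxi : inner ℝ (x i) (x i) = (1 : ℝ) := by
    rw [real_inner_self_eq_norm_sq, hx, one_pow]
  -- both sides of the hyperplane orthogonal to `x i` meet the cell in a nonempty open set
  have key : ∀ σ : ℝ, σ ≠ 0 → ∃ w ∈ U, 0 < σ * inner ℝ w (x i) ∧ feature x v w = 0 := by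
    intro σ hσ
    set V := U ∩ {w | 0 < σ * inner ℝ w (x i)} with hV
    have hVo : IsOpen V := hUo.inter (isOpen_lt continuous_const (by fun_prop))
    have hVne : V.Nonempty := by
      have hcont : Continuous fun s : ℝ => z + (s * σ) • x i := by fun_prop
      have hev : ∀ᶠ s in nhdsWithin (0 : ℝ) (Set.Ioi 0), z + (s * σ) • x i ∈ U :=
        (hcont.tendsto' 0 z (by simp)).mono_left nhdsWithin_le_nhds |>.eventually
          (hUo.mem_nhds hzU)
      obtain ⟨s, hs, hs0⟩ := (hev.and self_mem_nhdsWithin).exists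
      refine ⟨_, hs, ?_⟩
      have hs0 : 0 < s := hs0
      have : σ * inner ℝ (z + (s * σ) • x i) (x i) = s * (σ * σ) := by
        rw [inner_add_left, hz, real_inner_smul_left, hxi]; ring
      simp only [Set.mem_ofPred_eq, this]
      exact mul_pos hs0 (mul_self_pos.2 hσ)
    have hpos : μ V ≠ 0 := (hVo.measure_pos μ hVne).ne'
    by_contra! hcon
    refine hpos (measure_mono_null (fun w hw => ?_) h)
    exact hcon w hw.1 hw.2
  obtain ⟨w₁, hw₁, hp₁, hf₁⟩ := key 1 one_ne_zero
  obtain ⟨w₂, hw₂, hp₂, hf₂⟩ := key (-1) (by norm_num)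
  have hdiff : feature x v w₁ - feature x v w₂ = v i • x i := by
    rw [feature, feature, ← Finset.sum_sub_distrib, Finset.sum_eq_single i]
    · rw [reluDeriv_of_pos (by linarith), reluDeriv_of_neg (by linarith)]
      simp
    · intro j _ hj
      simp only [hU, Set.mem_iInter] at hw₁ hw₂
      have h1 : 0 < inner ℝ w₁ (x j) * inner ℝ z (x j) := hw₁ j hj
      have h2 : 0 < inner ℝ w₂ (x j) * inner ℝ z (x j) := hw₂ j hj
      rcases lt_or_gt_of_ne (hz' j hj) with hneg | hpos
      · rw [reluDeriv_of_neg (neg_of_mul_pos_left h1 hneg.le),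
          reluDeriv_of_neg (neg_of_mul_pos_left h2 hneg.le), sub_self]
      · rw [reluDeriv_of_pos (pos_of_mul_pos_left h1 hpos.le),
          reluDeriv_of_pos (pos_of_mul_pos_left h2 hpos.le), sub_self]
    · simp
  rw [hf₁, hf₂, sub_zero] at hdiff
  have hne : x i ≠ 0 := by
    intro h0
    have := hx i
    simp [h0] at this
  exact (smul_eq_zero.1 hdiff.symm).resolve_right hne

lemma limitGram_posDef {n d : ℕ} {x : Fin n → EuclideanSpace ℝ (Fin d)}
    (hx : ∀ i, ‖x i‖ = 1) (hli : ∀ i j, i ≠ j → LinearIndependent ℝ ![x i, x j]) {ν : ℝ}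
    (hν : 0 < ν) : (limitGram x ν).PosDef := by
  refine Matrix.PosDef.of_dotProduct_mulVec_pos (limitGram_isHermitian x ν) fun v hv => ?_
  obtain ⟨hint, heq⟩ := limitGram_quadratic hx v ν
  rw [star_trivial, heq]
  have h0 : 0 ≤ ∫ w, ‖feature x v w‖ ^ 2 ∂(weightLaw d ν) := integral_nonneg fun w => sq_nonneg _
  refine h0.lt_of_ne fun h => hv ?_
  have := isOpenPosMeasure_weightLaw (d := d) hν
  refine eq_zero_of_feature_ae_eq_zero hx hli (weightLaw d ν) ?_
  filter_upwards [(integral_eq_zero_iff_of_nonneg (fun w => sq_nonneg _) hint).1 h.symm] with w hw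
  simpa using hw

/-! ### The smallest eigenvalue -/

lemma lambdaMin_mem_spectrum {n : ℕ} (hn : 0 < n) {A : Matrix (Fin n) (Fin n) ℝ}
    (hA : A.IsHermitian) : lambdaMin A ∈ spectrum ℝ A := by
  have : Nonempty (Fin n) := ⟨⟨0, hn⟩⟩
  rw [lambdaMin, hA.spectrum_real_eq_range_eigenvalues]
  exact (Set.range_nonempty _).csInf_mem (Set.finite_range _)

lemma lambdaMin_pos {n : ℕ} (hn : 0 < n) {A : Matrix (Fin n) (Fin n) ℝ} (hA : A.PosDef) :
    0 < lambdaMin A := by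
  have h := lambdaMin_mem_spectrum hn hA.isHermitian
  rw [hA.isHermitian.spectrum_real_eq_range_eigenvalues] at h
  obtain ⟨i, hi⟩ := h
  rw [← hi]
  exact hA.eigenvalues_pos i

lemma lambdaMin_mul_le {n : ℕ} {A : Matrix (Fin n) (Fin n) ℝ} (hA : A.IsHermitian)
    (v : Fin n → ℝ) : lambdaMin A * (v ⬝ᵥ v) ≤ v ⬝ᵥ A *ᵥ v := by
  have hbdd : BddBelow (spectrum ℝ A) := by
    rw [hA.spectrum_real_eq_range_eigenvalues]
    exact (Set.finite_range _).bddBelow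
  have hps : (A - algebraMap ℝ _ (lambdaMin A)).PosSemidef := by
    rw [Matrix.posSemidef_iff_isHermitian_and_spectrum_nonneg]
    constructor
    · refine hA.sub ?_
      rw [Algebra.algebraMap_eq_smul_one]
      exact Matrix.IsHermitian.ext fun i j => by simp [Matrix.one_apply, eq_comm]
    · rw [← spectrum.sub_singleton_eq]
      rintro _ ⟨s, hs, _, rfl, rfl⟩
      exact sub_nonneg.2 (csInf_le hbdd hs)
  have h := hps.dotProduct_mulVec_nonneg v
  rw [star_trivial, Matrix.sub_mulVec, dotProduct_sub, Algebra.algebraMap_eq_smul_one,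
    Matrix.smul_mulVec, Matrix.one_mulVec, dotProduct_smul, smul_eq_mul] at h
  linarith

lemma lambdaZero_pos {n d : ℕ} (hn : 0 < n) {x : Fin n → EuclideanSpace ℝ (Fin d)}
    (hx : ∀ i, ‖x i‖ = 1) (hli : ∀ i j, i ≠ j → LinearIndependent ℝ ![x i, x j]) {ν : ℝ}
    (hν : 0 < ν) : 0 < lambdaZero x ν :=
  lambdaMin_pos hn (limitGram_posDef hx hli hν)

lemma lambdaZero_le_one {n d : ℕ} (hn : 0 < n) {x : Fin n → EuclideanSpace ℝ (Fin d)}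
    (hx : ∀ i, ‖x i‖ = 1) (ν : ℝ) : lambdaZero x ν ≤ 1 := by
  have h := lambdaMin_mul_le (limitGram_isHermitian x ν) (Pi.single ⟨0, hn⟩ 1)
  simp only [single_dotProduct, Matrix.mulVec_single_one, one_mul, Pi.single_eq_same, mul_one,
    Matrix.col_apply] at h
  refine h.trans ?_
  rw [limitGram_apply]
  have hb := norm_integral_le_of_norm_le_const (μ := weightLaw d ν)
    (f := unitGram x ⟨0, hn⟩ ⟨0, hn⟩) (C := 1)
    (Filter.Eventually.of_forall (abs_unitGram_le hx ⟨0, hn⟩ ⟨0, hn⟩))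
  simp only [probReal_univ, mul_one] at hb
  exact (le_abs_self _).trans hb

/-! ### Sign patterns and the linearization of the network -/

/-- All weights as one Euclidean vector, indexed by the columns of the Jacobian. -/
noncomputable def flat {m d : ℕ} (w : Weights m d) : EuclideanSpace ℝ (Fin m × Fin d) :=
  WithLp.toLp 2 fun p => w p.1 p.2

/-- The hidden units whose activation pattern on input `x i` differs between `w` and `w'`. -/
noncomputable def flips {n m d : ℕ} (x : Fin n → EuclideanSpace ℝ (Fin d)) (w w' : Weights m d)
    (i : Fin n) : Finset (Fin m) :=
  open Classical in
  Finset.univ.filter fun r => reluDeriv (inner ℝ (w r) (x i)) ≠ reluDeriv (inner ℝ (w' r) (x i))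

/-- The hidden units whose pre-activation on input `x i` is at most `t` in absolute value. -/
noncomputable def nearKink {n m d : ℕ} (x : Fin n → EuclideanSpace ℝ (Fin d)) (w : Weights m d)
    (t : ℝ) (i : Fin n) : Finset (Fin m) :=
  open Classical in
  Finset.univ.filter fun r => |inner ℝ (w r) (x i)| ≤ t

lemma norm_toLp_sq {ι : Type*} [Fintype ι] (v : ι → ℝ) :
    ‖WithLp.toLp 2 v‖ ^ 2 = v ⬝ᵥ v := by
  rw [EuclideanSpace.real_norm_sq_eq]; simp [dotProduct, sq]

lemma norm_flat_sub_sq {m d : ℕ} (w w' : Weights m d) :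
    ‖flat w - flat w'‖ ^ 2 = ∑ r, ‖w r - w' r‖ ^ 2 := by
  simp_rw [EuclideanSpace.real_norm_sq_eq, Fintype.sum_prod_type]
  simp [flat]

lemma mem_flips {n m d : ℕ} {x : Fin n → EuclideanSpace ℝ (Fin d)} {w w' : Weights m d}
    {i : Fin n} {r : Fin m} : r ∈ flips x w w' i ↔
      reluDeriv (inner ℝ (w r) (x i)) ≠ reluDeriv (inner ℝ (w' r) (x i)) := by
  simp [flips]

lemma card_flips_le_add {n m d : ℕ} (x : Fin n → EuclideanSpace ℝ (Fin d)) (w₀ w w' : Weights m d)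
    (i : Fin n) :
    (flips x w w' i).card ≤ (flips x w₀ w i).card + (flips x w₀ w' i).card := by
  classical
  refine (Finset.card_le_card (fun r hr => ?_)).trans (Finset.card_union_le _ _)
  rw [Finset.mem_union]
  simp only [mem_flips] at hr ⊢
  by_contra! h
  exact hr (h.1.symm.trans h.2)

lemma abs_le_abs_sub_of_reluDeriv_ne {z z' : ℝ} (h : reluDeriv z ≠ reluDeriv z') :
    |z| ≤ |z' - z| := by
  unfold reluDeriv at h
  split_ifs at h with h1 h2 h2
  · simp at h
  · rw [abs_of_nonneg h1, abs_of_nonpos] <;> linarith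
  · rw [abs_of_neg (not_le.1 h1), abs_of_nonneg] <;> linarith
  · simp at h

/-- The ReLU agrees with its linearization unless the sign of its argument changes. -/
lemma abs_relu_sub_le (z z' : ℝ) :
    |relu z' - relu z - reluDeriv z * (z' - z)| ≤
      if reluDeriv z ≠ reluDeriv z' then |z' - z| else 0 := by
  unfold relu reluDeriv
  by_cases h1 : 0 ≤ z <;> by_cases h2 : 0 ≤ z'
  · simp [h1, h2]
  · have h2' := (not_le.1 h2).le
    simp only [h1, h2, if_true, if_false, max_eq_left h1, max_eq_right h2']
    norm_num
    rw [abs_of_nonneg (by linarith), abs_of_nonpos (by linarith)]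
    linarith
  · have h1' := (not_le.1 h1).le
    simp only [h1, h2, if_true, if_false, max_eq_left h2, max_eq_right h1']
    norm_num
    rw [abs_of_nonneg h2, abs_of_nonneg] <;> linarith
  · simp [h1, h2, (not_le.1 h1).le, (not_le.1 h2).le]

lemma abs_inner_sub_le {d : ℕ} {x : EuclideanSpace ℝ (Fin d)} (hx : ‖x‖ = 1)
    (w w' : EuclideanSpace ℝ (Fin d)) : |inner ℝ w' x - inner ℝ w x| ≤ ‖w' - w‖ := by
  rw [← inner_sub_left]
  simpa [hx] using abs_real_inner_le_norm (w' - w) x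

/-- A unit flips only if it starts near the kink or its weight moves far; by Chebyshev's inequality
few weights move far. -/
lemma card_flips_le {n m d : ℕ} {x : Fin n → EuclideanSpace ℝ (Fin d)} (hx : ∀ i, ‖x i‖ = 1)
    (w w' : Weights m d) {t : ℝ} (ht : 0 < t) (i : Fin n) :
    ((flips x w w' i).card : ℝ) ≤ ‖flat w' - flat w‖ ^ 2 / t ^ 2 + (nearKink x w t i).card := by
  classical
  set F : Finset (Fin m) := Finset.univ.filter fun r => t ≤ ‖w' r - w r‖
  have hF : (F.card : ℝ) ≤ ‖flat w' - flat w‖ ^ 2 / t ^ 2 := by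
    rw [le_div_iff₀ (by positivity), norm_flat_sub_sq, ← nsmul_eq_mul]
    calc F.card • t ^ 2 ≤ ∑ r ∈ F, ‖w' r - w r‖ ^ 2 := by
          refine Finset.card_nsmul_le_sum _ _ _ fun r hr => ?_
          have : t ≤ ‖w' r - w r‖ := (Finset.mem_filter.1 hr).2
          gcongr
      _ ≤ ∑ r, ‖w' r - w r‖ ^ 2 :=
          Finset.sum_le_sum_of_subset_of_nonneg (Finset.subset_univ _) fun _ _ _ => sq_nonneg _
  have hsub : flips x w w' i ⊆ F ∪ nearKink x w t i := by
    intro r hr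
    have h1 := (abs_le_abs_sub_of_reluDeriv_ne (mem_flips.1 hr)).trans
      (abs_inner_sub_le (hx i) (w r) (w' r))
    rw [Finset.mem_union]
    rcases le_total t ‖w' r - w r‖ with h | h
    · exact Or.inl (by simp [F, h])
    · exact Or.inr (by simp [nearKink, h1.trans h])
  have := (Finset.card_le_card hsub).trans (Finset.card_union_le _ _)
  calc ((flips x w w' i).card : ℝ) ≤ (F.card : ℝ) + (nearKink x w t i).card := by exact_mod_cast this
    _ ≤ _ := by gcongr

lemma jacobian_mulVec_flat_sub {n m d : ℕ} (x : Fin n → EuclideanSpace ℝ (Fin d)) (a : Fin m → ℝ)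
    (w w' : Weights m d) (i : Fin n) :
    (jacobian x a w *ᵥ (flat w' - flat w).ofLp) i = (1 / √m) * ∑ r, a r *
      (reluDeriv (inner ℝ (w r) (x i)) * (inner ℝ (w' r) (x i) - inner ℝ (w r) (x i))) := by
  simp only [Matrix.mulVec, dotProduct, jacobian, Matrix.of_apply, Fintype.sum_prod_type,
    Finset.mul_sum, ← inner_sub_left]
  refine Finset.sum_congr rfl fun r _ => ?_
  rw [PiLp.inner_apply (w' r - w r)]
  simp only [Finset.mul_sum]
  refine Finset.sum_congr rfl fun j _ => ?_
  simp [flat]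
  ring

/-- The network outputs deviate from their linearization only through the units that flip. -/
lemma norm_outputs_linearization_sq_le {n m d : ℕ} {x : Fin n → EuclideanSpace ℝ (Fin d)}
    (hx : ∀ i, ‖x i‖ = 1) {a : Fin m → ℝ} (ha : ∀ r, |a r| = 1) (w w' : Weights m d) :
    ‖WithLp.toLp 2 (outputs x a w' - outputs x a w -
        jacobian x a w *ᵥ (flat w' - flat w).ofLp)‖ ^ 2 ≤
      (∑ i, ((flips x w w' i).card : ℝ)) / m * ‖flat w' - flat w‖ ^ 2 := by
  classical
  rw [EuclideanSpace.real_norm_sq_eq, Finset.sum_div, Finset.sum_mul]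
  refine Finset.sum_le_sum fun i _ => ?_
  set S := flips x w w' i with hS
  have hexpr : (outputs x a w' - outputs x a w -
        jacobian x a w *ᵥ (flat w' - flat w).ofLp) i =
      (1 / √m) * ∑ r, a r * (relu (inner ℝ (w' r) (x i)) - relu (inner ℝ (w r) (x i)) -
        reluDeriv (inner ℝ (w r) (x i)) * (inner ℝ (w' r) (x i) - inner ℝ (w r) (x i))) := by
    simp only [Pi.sub_apply, jacobian_mulVec_flat_sub, outputs, network, ← mul_sub,
      ← Finset.sum_sub_distrib]
  have habs : |∑ r, a r * (relu (inner ℝ (w' r) (x i)) - relu (inner ℝ (w r) (x i)) -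
        reluDeriv (inner ℝ (w r) (x i)) * (inner ℝ (w' r) (x i) - inner ℝ (w r) (x i)))| ≤
      ∑ r ∈ S, ‖w' r - w r‖ := by
    refine (Finset.abs_sum_le_sum_abs _ _).trans ?_
    rw [hS, flips, Finset.sum_filter]
    refine Finset.sum_le_sum fun r _ => ?_
    rw [abs_mul, ha, one_mul]
    refine (abs_relu_sub_le _ _).trans ?_
    split_ifs with h
    · exact abs_inner_sub_le (hx i) _ _
    · exact le_rfl
  calc ((outputs x a w' - outputs x a w -
        jacobian x a w *ᵥ (flat w' - flat w).ofLp) i) ^ 2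
      ≤ (1 / √m) ^ 2 * (∑ r ∈ S, ‖w' r - w r‖) ^ 2 := by
        rw [hexpr, mul_pow, ← sq_abs (∑ r, _)]
        gcongr
    _ ≤ (1 / √m) ^ 2 * (S.card * ∑ r ∈ S, ‖w' r - w r‖ ^ 2) := by
        gcongr
        exact sq_sum_le_card_mul_sum_sq
    _ ≤ (1 / √m) ^ 2 * (S.card * ∑ r, ‖w' r - w r‖ ^ 2) := by
        gcongr
        exact Finset.subset_univ _
    _ = (S.card : ℝ) / m * ‖flat w' - flat w‖ ^ 2 := by
        rw [norm_flat_sub_sq, div_pow, Real.sq_sqrt (Nat.cast_nonneg m)]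
        ring

lemma norm_transpose_mulVec_sq_le {ι κ : Type*} [Fintype ι] [Fintype κ] (A : Matrix ι κ ℝ)
    (v : ι → ℝ) :
    ‖WithLp.toLp 2 (Aᵀ *ᵥ v)‖ ^ 2 ≤ (∑ i, ∑ p, A i p ^ 2) * ‖WithLp.toLp 2 v‖ ^ 2 := by
  rw [EuclideanSpace.real_norm_sq_eq, EuclideanSpace.real_norm_sq_eq, Finset.sum_comm,
    Finset.sum_mul]
  refine Finset.sum_le_sum fun p _ => ?_
  simp only [Matrix.mulVec, dotProduct, Matrix.transpose_apply]
  exact Finset.sum_mul_sq_le_sq_mul_sq _ _ _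

/-- The Frobenius distance of two Jacobians is controlled by the number of flips. -/
lemma sum_sq_jacobian_sub {n m d : ℕ} {x : Fin n → EuclideanSpace ℝ (Fin d)}
    (hx : ∀ i, ‖x i‖ = 1) {a : Fin m → ℝ} (ha : ∀ r, |a r| = 1) (w w' : Weights m d) :
    ∑ i, ∑ p, (jacobian x a w - jacobian x a w') i p ^ 2 =
      (∑ i, ((flips x w w' i).card : ℝ)) / m := by
  classical
  rw [Finset.sum_div]
  refine Finset.sum_congr rfl fun i _ => ?_
  have hxi : ∑ j, x i j ^ 2 = 1 := by
    rw [← EuclideanSpace.real_norm_sq_eq, hx, one_pow]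
  have hterm : ∀ r : Fin m, ∑ j, (jacobian x a w - jacobian x a w') i (r, j) ^ 2 =
      if reluDeriv (inner ℝ (w r) (x i)) ≠ reluDeriv (inner ℝ (w' r) (x i)) then 1 / (m : ℝ)
      else 0 := by
    intro r
    have h1 : ∀ j, (jacobian x a w - jacobian x a w') i (r, j) ^ 2 =
        1 / (m : ℝ) * (reluDeriv (inner ℝ (w r) (x i)) - reluDeriv (inner ℝ (w' r) (x i))) ^ 2 *
          x i j ^ 2 := by
      intro j
      have hs : (1 / √(m : ℝ)) ^ 2 = 1 / (m : ℝ) := by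
        rw [div_pow, Real.sq_sqrt (Nat.cast_nonneg m), one_pow]
      have har : a r ^ 2 = 1 := by rw [← sq_abs, ha, one_pow]
      simp only [jacobian, Matrix.sub_apply, Matrix.of_apply]
      linear_combination (1 / √(m : ℝ)) ^ 2 * (reluDeriv (inner ℝ (w r) (x i)) -
        reluDeriv (inner ℝ (w' r) (x i))) ^ 2 * x i j ^ 2 * har +
        (reluDeriv (inner ℝ (w r) (x i)) - reluDeriv (inner ℝ (w' r) (x i))) ^ 2 * x i j ^ 2 * hs
    simp_rw [h1, ← Finset.mul_sum, hxi]
    rcases reluDeriv_eq_zero_or_one (inner ℝ (w r) (x i)) with h1 | h1 <;>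
    rcases reluDeriv_eq_zero_or_one (inner ℝ (w' r) (x i)) with h2 | h2 <;> simp [h1, h2]
  rw [Fintype.sum_prod_type]
  simp_rw [hterm]
  rw [flips, ← Finset.sum_filter, Finset.sum_const, nsmul_eq_mul]
  ring

lemma dotProduct_gram_mulVec {n m d : ℕ} (x : Fin n → EuclideanSpace ℝ (Fin d)) (a : Fin m → ℝ)
    (w : Weights m d) (v : Fin n → ℝ) :
    v ⬝ᵥ gram x a w *ᵥ v = ‖WithLp.toLp 2 ((jacobian x a w)ᵀ *ᵥ v)‖ ^ 2 := by
  rw [norm_toLp_sq, gram, ← Matrix.mulVec_mulVec, Matrix.dotProduct_mulVec,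
    Matrix.mulVec_transpose]

lemma isUnit_of_forall_mul_norm_sq_le {n : ℕ} {A : Matrix (Fin n) (Fin n) ℝ} {c : ℝ} (hc : 0 < c)
    (h : ∀ v, c * ‖WithLp.toLp 2 v‖ ^ 2 ≤ v ⬝ᵥ A *ᵥ v) : IsUnit A := by
  rw [← Matrix.mulVec_injective_iff_isUnit]
  refine (injective_iff_map_eq_zero A.mulVecLin).2 fun v hv => ?_
  have h1 := h v
  rw [Matrix.mulVecLin_apply] at hv
  rw [hv, dotProduct_zero] at h1
  have h2 : ‖WithLp.toLp 2 v‖ ^ 2 = 0 := by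
    nlinarith [sq_nonneg ‖WithLp.toLp 2 v‖]
  simpa using h2

/-- The natural gradient `Jᵀ G⁻¹ b` is a vector of norm at most `‖b‖ / √c` that the Jacobian maps
to `b`, where `c` bounds the spectrum of `G` from below. -/
lemma norm_natural_gradient_sq_le {n m d : ℕ} {x : Fin n → EuclideanSpace ℝ (Fin d)}
    {a : Fin m → ℝ} {w : Weights m d} {c : ℝ} (hc : 0 < c)
    (h : ∀ v, c * ‖WithLp.toLp 2 v‖ ^ 2 ≤ ‖WithLp.toLp 2 ((jacobian x a w)ᵀ *ᵥ v)‖ ^ 2)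
    (b : Fin n → ℝ) :
    jacobian x a w *ᵥ ((jacobian x a w)ᵀ *ᵥ ((gram x a w)⁻¹ *ᵥ b)) = b ∧
    c * ‖WithLp.toLp 2 ((jacobian x a w)ᵀ *ᵥ ((gram x a w)⁻¹ *ᵥ b))‖ ^ 2 ≤
      ‖WithLp.toLp 2 b‖ ^ 2 := by
  have hG : IsUnit (gram x a w) := isUnit_of_forall_mul_norm_sq_le hc fun v => by
    rw [dotProduct_gram_mulVec]; exact h v
  set z := (gram x a w)⁻¹ *ᵥ b with hz
  have hGz : gram x a w *ᵥ z = b := by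
    rw [hz, Matrix.mulVec_mulVec, Matrix.mul_nonsing_inv _ ((Matrix.isUnit_iff_isUnit_det _).1 hG),
      Matrix.one_mulVec]
  refine ⟨by rw [Matrix.mulVec_mulVec]; exact hGz, ?_⟩
  have h1 := h z
  have h2 : ‖WithLp.toLp 2 ((jacobian x a w)ᵀ *ᵥ z)‖ ^ 2 ≤
      ‖WithLp.toLp 2 z‖ * ‖WithLp.toLp 2 b‖ := by
    rw [← dotProduct_gram_mulVec, hGz]
    have := real_inner_le_norm (WithLp.toLp 2 b) (WithLp.toLp 2 z)
    rw [EuclideanSpace.inner_toLp_toLp, star_trivial] at this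
    linarith
  set J := ‖WithLp.toLp 2 ((jacobian x a w)ᵀ *ᵥ z)‖
  have hZ : 0 ≤ ‖WithLp.toLp 2 z‖ := norm_nonneg _
  have hB : 0 ≤ ‖WithLp.toLp 2 b‖ := norm_nonneg _
  set Z := ‖WithLp.toLp 2 z‖
  set B := ‖WithLp.toLp 2 b‖
  have h3 : c * Z ≤ B := by
    by_contra! hcon
    have : 0 < Z := by
      by_contra! h0
      have : Z = 0 := le_antisymm h0 hZ
      rw [this, mul_zero] at hcon
      linarith
    nlinarith
  nlinarith

/-! ### Convergence from a well-conditioned initialization -/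

/-- A lower bound on the spectrum of the Gram matrix survives a change of the weights that flips few
activations. -/
lemma mul_norm_sq_le_of_sum_card_flips_le {n m d : ℕ} {x : Fin n → EuclideanSpace ℝ (Fin d)}
    (hx : ∀ i, ‖x i‖ = 1) {a : Fin m → ℝ} (ha : ∀ r, |a r| = 1) {w₀ w : Weights m d} {L ε : ℝ}
    (hL : 0 ≤ L) (hε : ε ≤ 1 / 512)
    (h₀ : ∀ v, L / 2 * ‖WithLp.toLp 2 v‖ ^ 2 ≤ ‖WithLp.toLp 2 ((jacobian x a w₀)ᵀ *ᵥ v)‖ ^ 2)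
    (hflip : (∑ i, ((flips x w₀ w i).card : ℝ)) / m ≤ 4 * ε * L) (v : Fin n → ℝ) :
    L / 16 * ‖WithLp.toLp 2 v‖ ^ 2 ≤ ‖WithLp.toLp 2 ((jacobian x a w)ᵀ *ᵥ v)‖ ^ 2 := by
  set p := WithLp.toLp 2 ((jacobian x a w)ᵀ *ᵥ v)
  set e := WithLp.toLp 2 ((jacobian x a w₀ - jacobian x a w)ᵀ *ᵥ v)
  have hsplit : WithLp.toLp 2 ((jacobian x a w₀)ᵀ *ᵥ v) = p + e := by
    rw [← WithLp.toLp_add, ← Matrix.add_mulVec, ← Matrix.transpose_add, add_sub_cancel]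
  have h1 := h₀ v
  rw [hsplit] at h1
  have h2 : ‖p + e‖ ^ 2 ≤ 2 * (‖p‖ ^ 2 + ‖e‖ ^ 2) :=
    (pow_le_pow_left₀ (norm_nonneg _) (norm_add_le p e) 2).trans add_sq_le
  have h3 : ‖e‖ ^ 2 ≤ 4 * ε * L * ‖WithLp.toLp 2 v‖ ^ 2 := by
    refine (norm_transpose_mulVec_sq_le _ v).trans ?_
    rw [sum_sq_jacobian_sub hx ha]
    gcongr
  have h4 : 4 * ε * L * ‖WithLp.toLp 2 v‖ ^ 2 ≤ 4 * (1 / 512) * L * ‖WithLp.toLp 2 v‖ ^ 2 := by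
    gcongr
  have h5 : 0 ≤ L * ‖WithLp.toLp 2 v‖ ^ 2 := by positivity
  linarith

lemma flat_ngdStep_sub {n m d : ℕ} (x : Fin n → EuclideanSpace ℝ (Fin d)) (y : Fin n → ℝ)
    (η : ℝ) (a : Fin m → ℝ) (w : Weights m d) :
    flat (ngdStep x y η a w) - flat w =
      -η • WithLp.toLp 2 ((jacobian x a w)ᵀ *ᵥ ((gram x a w)⁻¹ *ᵥ (outputs x a w - y))) := by
  ext p
  simp [flat, ngdStep]

/-- One step of natural gradient descent moves the weights by `O(η / √L)` times the residual, where
`L / 16` bounds the spectrum of the Gram matrix from below. -/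
lemma norm_flat_ngdStep_sub_sq_le {n m d : ℕ} {x : Fin n → EuclideanSpace ℝ (Fin d)}
    {a : Fin m → ℝ} {w : Weights m d} {L : ℝ} (hL : 0 < L)
    (h : ∀ v, L / 16 * ‖WithLp.toLp 2 v‖ ^ 2 ≤ ‖WithLp.toLp 2 ((jacobian x a w)ᵀ *ᵥ v)‖ ^ 2)
    (y : Fin n → ℝ) (η : ℝ) :
    L * ‖flat (ngdStep x y η a w) - flat w‖ ^ 2 ≤
      16 * η ^ 2 * ‖WithLp.toLp 2 (outputs x a w - y)‖ ^ 2 := by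
  have h1 := (norm_natural_gradient_sq_le (by positivity) h (outputs x a w - y)).2
  rw [flat_ngdStep_sub, norm_smul, mul_pow, norm_neg, Real.norm_eq_abs, sq_abs]
  nlinarith [sq_nonneg η]

/-- One step of natural gradient descent multiplies the residual by `1 - η`, up to the linearization
error. -/
lemma norm_outputs_ngdStep_sub_le {n m d : ℕ} {x : Fin n → EuclideanSpace ℝ (Fin d)}
    (hx : ∀ i, ‖x i‖ = 1) {a : Fin m → ℝ} (ha : ∀ r, |a r| = 1) {w : Weights m d} {L γ η : ℝ}
    (hL : 0 < L) (hγ : 0 ≤ γ) (hη : 0 < η) (hη1 : η ≤ 1)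
    (h : ∀ v, L / 16 * ‖WithLp.toLp 2 v‖ ^ 2 ≤ ‖WithLp.toLp 2 ((jacobian x a w)ᵀ *ᵥ v)‖ ^ 2)
    (y : Fin n → ℝ)
    (hflip : (∑ i, ((flips x w (ngdStep x y η a w) i).card : ℝ)) / m ≤ γ ^ 2 / 16 * L) :
    ‖WithLp.toLp 2 (outputs x a (ngdStep x y η a w) - y)‖ ≤
      (1 - η * (1 - γ)) * ‖WithLp.toLp 2 (outputs x a w - y)‖ := by
  set w' := ngdStep x y η a w with hw'
  set b := outputs x a w - y with hb
  set e := outputs x a w' - outputs x a w - jacobian x a w *ᵥ (flat w' - flat w).ofLp with he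
  have hJ : jacobian x a w *ᵥ (flat w' - flat w).ofLp = -η • b := by
    rw [hw', flat_ngdStep_sub, WithLp.ofLp_smul, Matrix.mulVec_smul,
      (norm_natural_gradient_sq_le (by positivity) h b).1]
  have hsum : outputs x a w' - y = (1 - η) • b + e := by
    rw [he, hJ, hb]
    module
  have hstep := norm_flat_ngdStep_sub_sq_le hL h y η
  have herr : ‖WithLp.toLp 2 e‖ ^ 2 ≤ (γ * η * ‖WithLp.toLp 2 b‖) ^ 2 := by
    calc ‖WithLp.toLp 2 e‖ ^ 2
        ≤ (∑ i, ((flips x w w' i).card : ℝ)) / m * ‖flat w' - flat w‖ ^ 2 :=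
          norm_outputs_linearization_sq_le hx ha w w'
      _ ≤ γ ^ 2 / 16 * L * ‖flat w' - flat w‖ ^ 2 := by gcongr
      _ = γ ^ 2 / 16 * (L * ‖flat w' - flat w‖ ^ 2) := by ring
      _ ≤ γ ^ 2 / 16 * (16 * η ^ 2 * ‖WithLp.toLp 2 b‖ ^ 2) := by gcongr
      _ = (γ * η * ‖WithLp.toLp 2 b‖) ^ 2 := by ring
  have herr' := (sq_le_sq₀ (by positivity) (by positivity)).1 herr
  rw [hsum, WithLp.toLp_add, WithLp.toLp_smul]
  refine (norm_add_le _ _).trans ?_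
  rw [norm_smul, Real.norm_of_nonneg (by linarith)]
  linarith

/-- Natural gradient descent converges linearly, without leaving the ball of radius `R` around the
initialization, if the Gram matrix is well conditioned at the initialization and the weights in that
ball flip few activations. -/
lemma ngdIterate_converges {n m d : ℕ} {x : Fin n → EuclideanSpace ℝ (Fin d)}
    (hx : ∀ i, ‖x i‖ = 1) {a : Fin m → ℝ} (ha : ∀ r, |a r| = 1) {w₀ : Weights m d}
    {L R η η₀ : ℝ} (y : Fin n → ℝ) (hL : 0 < L) (hη : 0 < η) (hη₀ : η ≤ η₀) (hη₁ : η₀ < 1)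
    (h₀ : ∀ v, L / 2 * ‖WithLp.toLp 2 v‖ ^ 2 ≤ ‖WithLp.toLp 2 ((jacobian x a w₀)ᵀ *ᵥ v)‖ ^ 2)
    (hR : 8 * ‖WithLp.toLp 2 (outputs x a w₀ - y)‖ / √L ≤ R)
    (hflip : ∀ w, ‖flat w - flat w₀‖ ≤ R →
      ∑ i, ((flips x w₀ w i).card : ℝ) ≤ 4 * ((1 - η₀) ^ 2 / 512) * L * m) (k : ℕ) :
    IsUnit (gram x a (ngdIterate x y η a w₀ k)) ∧
    ‖WithLp.toLp 2 (outputs x a (ngdIterate x y η a w₀ k) - y)‖ ^ 2 ≤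
      (1 - η) ^ k * ‖WithLp.toLp 2 (outputs x a w₀ - y)‖ ^ 2 := by
  have hη₀' : 0 < η₀ := hη.trans_le hη₀
  set b₀ := ‖WithLp.toLp 2 (outputs x a w₀ - y)‖ with hb₀
  have hb₀' : 0 ≤ b₀ := norm_nonneg _
  have hR0 : 0 ≤ R := le_trans (by positivity) hR
  -- the contraction factor of a step with a relative linearization error of `(1 - η₀) / 2`
  set q : ℝ := 1 - η * (1 - (1 - η₀) / 2) with hq
  have hq0 : 0 < q := by rw [hq]; nlinarith
  have hq1 : q ≤ 1 := by rw [hq]; nlinarith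
  have hflip' : ∀ w, ‖flat w - flat w₀‖ ≤ R →
      (∑ i, ((flips x w₀ w i).card : ℝ)) / m ≤ 4 * ((1 - η₀) ^ 2 / 512) * L := fun w hw =>
    div_le_of_le_mul₀ (Nat.cast_nonneg m) (by positivity) (hflip w hw)
  have hcond : ∀ w, ‖flat w - flat w₀‖ ≤ R → ∀ v,
      L / 16 * ‖WithLp.toLp 2 v‖ ^ 2 ≤ ‖WithLp.toLp 2 ((jacobian x a w)ᵀ *ᵥ v)‖ ^ 2 :=
    fun w hw => mul_norm_sq_le_of_sum_card_flips_le hx ha hL.le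
      (by nlinarith) h₀ (hflip' w hw)
  have hinv : ∀ k, ‖flat (ngdIterate x y η a w₀ k) - flat w₀‖ ≤ (1 - q ^ k) * R ∧
      ‖WithLp.toLp 2 (outputs x a (ngdIterate x y η a w₀ k) - y)‖ ≤ q ^ k * b₀ := by
    intro k
    induction k with
    | zero => simp [ngdIterate, hb₀]
    | succ k ih =>
      obtain ⟨ih1, ih2⟩ := ih
      set w := ngdIterate x y η a w₀ k
      have hqk : 0 < q ^ k := pow_pos hq0 k
      have hwR : ‖flat w - flat w₀‖ ≤ R := ih1.trans (by nlinarith)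
      have hstep : ‖flat (ngdStep x y η a w) - flat w‖ ≤
          4 * η * ‖WithLp.toLp 2 (outputs x a w - y)‖ / √L := by
        have h1 := norm_flat_ngdStep_sub_sq_le hL (hcond w hwR) y η
        rw [le_div_iff₀ (Real.sqrt_pos.2 hL)]
        refine (sq_le_sq₀ (by positivity) (by positivity)).1 ?_
        rw [mul_pow, Real.sq_sqrt hL.le]
        linarith
      have hw'1 : ‖flat (ngdStep x y η a w) - flat w₀‖ ≤ (1 - q ^ (k + 1)) * R := by
        have h1 : 4 * η * ‖WithLp.toLp 2 (outputs x a w - y)‖ / √L ≤ q ^ k * ((1 - q) * R) := by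
          calc 4 * η * ‖WithLp.toLp 2 (outputs x a w - y)‖ / √L
              ≤ 4 * η * (q ^ k * b₀) / √L := by gcongr
            _ = q ^ k * (η / 2 * (8 * b₀ / √L)) := by ring
            _ ≤ q ^ k * (η / 2 * R) := by gcongr
            _ ≤ q ^ k * ((1 - q) * R) := by
              gcongr
              rw [hq]; nlinarith
        calc ‖flat (ngdStep x y η a w) - flat w₀‖
            ≤ ‖flat (ngdStep x y η a w) - flat w‖ + ‖flat w - flat w₀‖ :=
              norm_sub_le_norm_sub_add_norm_sub _ _ _
          _ ≤ q ^ k * ((1 - q) * R) + (1 - q ^ k) * R := add_le_add (hstep.trans h1) ih1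
          _ = (1 - q ^ (k + 1)) * R := by ring
      have hw'R : ‖flat (ngdStep x y η a w) - flat w₀‖ ≤ R :=
        hw'1.trans (by nlinarith [pow_pos hq0 (k + 1)])
      refine ⟨hw'1, ?_⟩
      have hfl : (∑ i, ((flips x w (ngdStep x y η a w) i).card : ℝ)) / m ≤
          ((1 - η₀) / 2) ^ 2 / 16 * L := by
        have h1 : ∑ i, ((flips x w (ngdStep x y η a w) i).card : ℝ) ≤
            ∑ i, ((flips x w₀ w i).card : ℝ) +
              ∑ i, ((flips x w₀ (ngdStep x y η a w) i).card : ℝ) := by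
          rw [← Finset.sum_add_distrib]
          exact Finset.sum_le_sum fun i _ => by exact_mod_cast card_flips_le_add x w₀ w _ i
        calc (∑ i, ((flips x w (ngdStep x y η a w) i).card : ℝ)) / m
            ≤ (∑ i, ((flips x w₀ w i).card : ℝ) +
              ∑ i, ((flips x w₀ (ngdStep x y η a w) i).card : ℝ)) / m := by gcongr
          _ ≤ 4 * ((1 - η₀) ^ 2 / 512) * L + 4 * ((1 - η₀) ^ 2 / 512) * L := by
              rw [add_div]
              exact add_le_add (hflip' w hwR) (hflip' _ hw'R)
          _ = ((1 - η₀) / 2) ^ 2 / 16 * L := by ring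
      have hres := norm_outputs_ngdStep_sub_le hx ha hL (by linarith) hη (by linarith)
        (hcond w hwR) y hfl
      calc _ ≤ q * ‖WithLp.toLp 2 (outputs x a w - y)‖ := hres
        _ ≤ q * (q ^ k * b₀) := by gcongr
        _ = q ^ (k + 1) * b₀ := by ring
  obtain ⟨h1, h2⟩ := hinv k
  have hwR : ‖flat (ngdIterate x y η a w₀ k) - flat w₀‖ ≤ R :=
    h1.trans (by nlinarith [pow_pos hq0 k])
  constructor
  · refine isUnit_of_forall_mul_norm_sq_le (c := L / 16) (by positivity) fun v => ?_
    rw [dotProduct_gram_mulVec]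
    exact hcond _ hwR v
  · have hq2 : q ^ 2 ≤ 1 - η := by
      rw [hq]
      -- the claim is `η (1 + η₀)² ≤ 4 η₀` times `η / 4`
      have h4 : η * (1 + η₀) ^ 2 ≤ η₀ * 4 :=
        mul_le_mul hη₀ (by nlinarith) (sq_nonneg _) hη₀'.le
      linarith [mul_le_mul_of_nonneg_left h4 hη.le]
    calc _ ≤ (q ^ k * b₀) ^ 2 := by gcongr
      _ = (q ^ 2) ^ k * b₀ ^ 2 := by rw [mul_pow, pow_right_comm]
      _ ≤ (1 - η) ^ k * b₀ ^ 2 := by gcongr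

/-! ### Moment bounds at the random initialization -/

lemma signLaw_eq : signLaw = (2⁻¹ : ENNReal) • (Measure.dirac (-1) + Measure.dirac 1) := by
  classical
  ext t ht
  have hs : ({-1, 1} : Set ℝ) = (({-1, 1} : Finset ℝ) : Set ℝ) := by simp
  rw [signLaw, hs, uniformOn, cond_apply (Finset.measurableSet _), Measure.count_apply_finset]
  have hcard : (({-1, 1} : Finset ℝ).card) = 2 := by
    rw [Finset.card_insert_of_notMem (by norm_num), Finset.card_singleton]
  have hne : (-1 : ℝ) ≠ 1 := by norm_num
  rw [hcard, ← hs, Set.insert_eq, Set.union_inter_distrib_right,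
    measure_union _ ((measurableSet_singleton _).inter ht)]
  · simp only [Measure.smul_apply, Measure.add_apply, smul_eq_mul, Nat.cast_ofNat,
      Measure.dirac_apply' _ ht]
    congr 2
    · by_cases h : (-1 : ℝ) ∈ t <;> simp [h]
    · by_cases h : (1 : ℝ) ∈ t <;> simp [h]
  · refine Set.disjoint_left.2 fun z hz hz' => ?_
    rw [Set.mem_singleton_iff.1 hz.1] at hz'
    exact hne (Set.mem_singleton_iff.1 hz'.1)

lemma ae_abs_eq_one_signLaw : ∀ᵐ a ∂signLaw, |a| = 1 := by
  rw [signLaw_eq]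
  refine Measure.ae_smul_measure ?_ _
  simp [ae_dirac_eq]

lemma integral_id_signLaw : ∫ a, a ∂signLaw = 0 := by
  rw [signLaw_eq, integral_smul_measure, integral_add_measure] <;>
    simp [integrable_dirac]

lemma memLp_id_signLaw : MemLp (fun a : ℝ => a) 2 signLaw :=
  MemLp.of_bound (by fun_prop) 1 (ae_abs_eq_one_signLaw.mono fun a ha => by
    rw [Real.norm_eq_abs, ha])

lemma variance_id_signLaw : Var[fun a => a; signLaw] = 1 := by
  rw [variance_eq_integral (by fun_prop), integral_id_signLaw]
  have : ∫ a, (a - 0) ^ 2 ∂signLaw = ∫ _, (1 : ℝ) ∂signLaw :=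
    integral_congr_ae (ae_abs_eq_one_signLaw.mono fun a ha => by
      change (a - 0) ^ 2 = 1
      rw [sub_zero, ← sq_abs, ha, one_pow])
  rw [this]
  simp

lemma lintegral_sum_sub_sq_pi {ι Ω : Type*} [Fintype ι] [MeasurableSpace Ω] (μ : Measure Ω)
    [IsProbabilityMeasure μ] {X : ι → Ω → ℝ} (hX : ∀ i, MemLp (X i) 2 μ) :
    ∫⁻ ω, ENNReal.ofReal ((∑ i, X i (ω i) - ∑ i, ∫ z, X i z ∂μ) ^ 2) ∂(Measure.pi fun _ : ι => μ) =
      ENNReal.ofReal (∑ i, Var[X i; μ]) := by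
  have hmem : ∀ i, MemLp (fun ω : ι → Ω => X i (ω i)) 2 (Measure.pi fun _ : ι => μ) := fun i =>
    (hX i).comp_measurePreserving (measurePreserving_eval (fun _ : ι => μ) i)
  have hsum : MemLp (∑ i, fun ω : ι → Ω => X i (ω i)) 2 (Measure.pi fun _ : ι => μ) :=
    memLp_finsetSum' _ fun i _ => hmem i
  rw [← variance_sum_pi hX, hsum.ofReal_variance_eq, evariance_eq_lintegral_ofReal]
  refine lintegral_congr fun ω => ?_
  have hint : ∫ ω, (∑ i, fun ω : ι → Ω => X i (ω i)) ω ∂(Measure.pi fun _ : ι => μ) =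
      ∑ i, ∫ z, X i z ∂μ := by
    simp only [Finset.sum_apply]
    rw [integral_finsetSum _ fun i _ => (hmem i).integrable one_le_two]
    refine Finset.sum_congr rfl fun i _ => ?_
    exact integral_comp_eval (μ := fun _ : ι => μ) (hX i).aestronglyMeasurable
  rw [hint, Finset.sum_apply]

lemma lintegral_comp_eval_pi {ι Ω : Type*} [Fintype ι] [MeasurableSpace Ω] (μ : Measure Ω)
    [IsProbabilityMeasure μ] {f : Ω → ENNReal} (hf : Measurable f) (i : ι) :
    ∫⁻ ω, f (ω i) ∂(Measure.pi fun _ : ι => μ) = ∫⁻ z, f z ∂μ :=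
  (measurePreserving_eval (fun _ : ι => μ) i).lintegral_comp hf

lemma lintegral_fst_initLaw {m d : ℕ} {ν : ℝ} {f : Weights m d → ENNReal} (hf : Measurable f) :
    ∫⁻ ω, f ω.1 ∂(initLaw m d ν) = ∫⁻ w, f w ∂(Measure.pi fun _ : Fin m => weightLaw d ν) :=
  measurePreserving_fst.lintegral_comp hf

lemma ae_abs_eq_one_initLaw (m d : ℕ) (ν : ℝ) : ∀ᵐ ω ∂(initLaw m d ν), ∀ r, |ω.2 r| = 1 := by
  have h : ∀ᵐ a ∂(Measure.pi fun _ : Fin m => signLaw), ∀ r, |a r| = 1 := by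
    rw [ae_all_iff]
    exact fun r => (measurePreserving_eval (fun _ : Fin m => signLaw) r).quasiMeasurePreserving.ae
      ae_abs_eq_one_signLaw
  exact (measurePreserving_snd (μ := Measure.pi fun _ : Fin m => weightLaw d ν)
    (ν := Measure.pi fun _ : Fin m => signLaw)).quasiMeasurePreserving.ae h

instance (m d : ℕ) (ν : ℝ) : IsProbabilityMeasure (initLaw m d ν) := by
  unfold initLaw; infer_instance

@[fun_prop]
lemma measurable_relu : Measurable relu := measurable_id.max measurable_const

lemma measurable_outputs {n m d : ℕ} (x : Fin n → EuclideanSpace ℝ (Fin d)) (i : Fin n) :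
    Measurable fun ω : Weights m d × (Fin m → ℝ) => outputs x ω.2 ω.1 i := by
  unfold outputs network
  fun_prop

/-- Averaging over the signs of the output layer first, the cross terms of distinct hidden units
vanish, so that an output has second moment at most `ν²`, whatever the width. -/
lemma lintegral_outputs_sq_le {n m d : ℕ} {x : Fin n → EuclideanSpace ℝ (Fin d)}
    (hx : ∀ i, ‖x i‖ = 1) (ν : ℝ) (i : Fin n) :
    ∫⁻ ω, ENNReal.ofReal (outputs x ω.2 ω.1 i ^ 2) ∂(initLaw m d ν) ≤ ENNReal.ofReal (ν ^ 2) := by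
  unfold initLaw
  rw [lintegral_prod _ ((measurable_outputs x i).pow_const 2).ennreal_ofReal.aemeasurable]
  have hinner : ∀ w : Weights m d,
      ∫⁻ a, ENNReal.ofReal (outputs x a w i ^ 2) ∂(Measure.pi fun _ : Fin m => signLaw) ≤
        ∑ r, ENNReal.ofReal (1 / m) * ENNReal.ofReal (inner ℝ (w r) (x i) ^ 2) := by
    intro w
    let c : Fin m → ℝ := fun r => (1 / √m) * relu (inner ℝ (w r) (x i))
    have h : ∫⁻ a, ENNReal.ofReal ((∑ r, c r * a r) ^ 2)
        ∂(Measure.pi fun _ : Fin m => signLaw) = ENNReal.ofReal (∑ r, c r ^ 2) := by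
      have h0 := lintegral_sum_sub_sq_pi signLaw (X := fun (r : Fin m) (a : ℝ) => c r * a)
        (fun r => memLp_id_signLaw.const_mul (c r))
      have h1 : ∀ r, ∫ z, c r * z ∂signLaw = 0 := fun r => by
        rw [integral_const_mul, integral_id_signLaw, mul_zero]
      have h2 : ∀ r, Var[fun z => c r * z; signLaw] = c r ^ 2 := fun r => by
        rw [variance_const_mul, variance_id_signLaw, mul_one]
      simpa only [h1, h2, Finset.sum_const_zero, sub_zero] using h0
    have hout : ∀ a, outputs x a w i = ∑ r, c r * a r := by
      intro a
      rw [outputs, network, Finset.mul_sum]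
      exact Finset.sum_congr rfl fun r _ => by simp only [c]; ring
    simp_rw [hout, h]
    rw [ENNReal.ofReal_sum_of_nonneg fun r _ => sq_nonneg _]
    refine Finset.sum_le_sum fun r _ => ?_
    rw [← ENNReal.ofReal_mul (by positivity)]
    refine ENNReal.ofReal_le_ofReal ?_
    simp only [c]
    rw [mul_pow, div_pow, Real.sq_sqrt (Nat.cast_nonneg m), one_pow]
    gcongr ?_ * ?_
    refine sq_le_sq.2 ?_
    rw [relu, abs_of_nonneg (le_max_right _ _)]
    exact max_le (le_abs_self _) (abs_nonneg _)
  refine (lintegral_mono hinner).trans ?_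
  rw [lintegral_finsetSum _ fun r _ => by fun_prop]
  have hr : ∀ r : Fin m, ∫⁻ w, ENNReal.ofReal (1 / m) *
      ENNReal.ofReal (inner ℝ (w r) (x i) ^ 2) ∂(Measure.pi fun _ : Fin m => weightLaw d ν) =
      ENNReal.ofReal (1 / m) * ENNReal.ofReal (ν ^ 2) := fun r => by
    rw [lintegral_const_mul _ (by fun_prop), lintegral_comp_eval_pi (weightLaw d ν)
      (f := fun z => ENNReal.ofReal (inner ℝ z (x i) ^ 2)) (by fun_prop) r,
      lintegral_inner_sq_weightLaw (hx i)]
  simp_rw [hr, ← ENNReal.ofReal_mul (show (0 : ℝ) ≤ 1 / m by positivity)]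
  rw [Finset.sum_const, Finset.card_univ, Fintype.card_fin, nsmul_eq_mul,
    ← ENNReal.ofReal_natCast, ← ENNReal.ofReal_mul (Nat.cast_nonneg m)]
  refine ENNReal.ofReal_le_ofReal ?_
  rcases Nat.eq_zero_or_pos m with rfl | hm
  · simpa using sq_nonneg ν
  · have : (0 : ℝ) < m := by exact_mod_cast hm
    field_simp
    exact le_rfl

lemma gram_apply {n m d : ℕ} (x : Fin n → EuclideanSpace ℝ (Fin d)) {a : Fin m → ℝ}
    (ha : ∀ r, |a r| = 1) (w : Weights m d) (i j : Fin n) :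
    gram x a w i j = (∑ r, unitGram x i j (w r)) / m := by
  rw [gram, Matrix.mul_apply, Fintype.sum_prod_type, Finset.sum_div]
  refine Finset.sum_congr rfl fun r _ => ?_
  rw [unitGram, PiLp.inner_apply (x i), Finset.mul_sum, Finset.sum_div]
  refine Finset.sum_congr rfl fun k _ => ?_
  have hs : (1 / √(m : ℝ)) ^ 2 = 1 / (m : ℝ) := by
    rw [div_pow, Real.sq_sqrt (Nat.cast_nonneg m), one_pow]
  have har : a r ^ 2 = 1 := by rw [← sq_abs, ha, one_pow]
  simp only [jacobian, Matrix.transpose_apply, Matrix.of_apply, RCLike.inner_apply, conj_trivial]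
  linear_combination (1 / √(m : ℝ)) ^ 2 * reluDeriv (inner ℝ (w r) (x i)) *
    reluDeriv (inner ℝ (w r) (x j)) * x i k * x j k * har +
    reluDeriv (inner ℝ (w r) (x i)) * reluDeriv (inner ℝ (w r) (x j)) * x i k * x j k * hs

/-- An entry of the Gram matrix is an average of `m` independent variables in `[-1, 1]`. -/
lemma lintegral_unitGram_average_sq_le {n m d : ℕ} {x : Fin n → EuclideanSpace ℝ (Fin d)}
    (hx : ∀ i, ‖x i‖ = 1) (ν : ℝ) (hm : 0 < m) (i j : Fin n) :
    ∫⁻ w, ENNReal.ofReal (((∑ r, unitGram x i j (w r)) / m - limitGram x ν i j) ^ 2)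
      ∂(Measure.pi fun _ : Fin m => weightLaw d ν) ≤ ENNReal.ofReal (1 / m) := by
  have hm' : (0 : ℝ) < m := by exact_mod_cast hm
  have h := lintegral_sum_sub_sq_pi (ι := Fin m) (weightLaw d ν) (X := fun _ => unitGram x i j)
    (fun _ => memLp_unitGram hx i j ν)
  have hvar : Var[unitGram x i j; weightLaw d ν] ≤ 1 := by
    refine (variance_le_sq_of_bounded (a := -1) (b := 1) (Filter.Eventually.of_forall fun w =>
      abs_le.1 (abs_unitGram_le hx i j w)) (by fun_prop)).trans (by norm_num)
  rw [← limitGram_apply, Finset.sum_const, Finset.sum_const, Finset.card_univ, Fintype.card_fin,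
    nsmul_eq_mul, nsmul_eq_mul] at h
  have hscale : ∀ w : Weights m d,
      ENNReal.ofReal (((∑ r, unitGram x i j (w r)) / m - limitGram x ν i j) ^ 2) =
      ENNReal.ofReal (1 / m ^ 2) *
        ENNReal.ofReal ((∑ r, unitGram x i j (w r) - m * limitGram x ν i j) ^ 2) := by
    intro w
    rw [← ENNReal.ofReal_mul (by positivity)]
    congr 1
    field_simp
  simp_rw [hscale]
  rw [lintegral_const_mul _ (by fun_prop), h, ← ENNReal.ofReal_mul (by positivity)]
  refine ENNReal.ofReal_le_ofReal ?_
  calc 1 / (m : ℝ) ^ 2 * ((m : ℝ) * Var[unitGram x i j; weightLaw d ν])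
      ≤ 1 / (m : ℝ) ^ 2 * ((m : ℝ) * 1) := by gcongr
    _ = 1 / (m : ℝ) := by field_simp

lemma card_nearKink_eq_sum {n m d : ℕ} (x : Fin n → EuclideanSpace ℝ (Fin d)) (w : Weights m d)
    (t : ℝ) (i : Fin n) : ((nearKink x w t i).card : ℝ) =
      ∑ r, {z | |inner ℝ z (x i)| ≤ t}.indicator (fun _ => (1 : ℝ)) (w r) := by
  classical
  rw [nearKink, Finset.card_filter]
  push_cast
  rfl

lemma measurableSet_abs_inner_le {d : ℕ} (x : EuclideanSpace ℝ (Fin d)) (t : ℝ) :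
    MeasurableSet {z : EuclideanSpace ℝ (Fin d) | |inner ℝ z x| ≤ t} :=
  measurableSet_le (by fun_prop) measurable_const

lemma measurable_card_nearKink {n m d : ℕ} (x : Fin n → EuclideanSpace ℝ (Fin d)) (t : ℝ)
    (i : Fin n) : Measurable fun w : Weights m d => ((nearKink x w t i).card : ℝ) := by
  simp_rw [card_nearKink_eq_sum]
  refine Finset.measurable_sum _ fun r _ => ?_
  exact (measurable_const.indicator (measurableSet_abs_inner_le (x i) t)).comp
    (measurable_pi_apply r)

lemma lintegral_card_nearKink_le {n m d : ℕ} {x : Fin n → EuclideanSpace ℝ (Fin d)}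
    (hx : ∀ i, ‖x i‖ = 1) {ν t : ℝ} (hν : 0 < ν) (i : Fin n) :
    ∫⁻ w, ENNReal.ofReal (nearKink x w t i).card ∂(Measure.pi fun _ : Fin m => weightLaw d ν) ≤
      ENNReal.ofReal (m * (t / ν)) := by
  set A := {z : EuclideanSpace ℝ (Fin d) | |inner ℝ z (x i)| ≤ t} with hA
  have hAm : MeasurableSet A := measurableSet_abs_inner_le (x i) t
  have hmeas : Measurable fun z => ENNReal.ofReal (A.indicator (fun _ => (1 : ℝ)) z) :=
    (measurable_const.indicator hAm).ennreal_ofReal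
  have hsum : ∀ w : Weights m d, ENNReal.ofReal ((nearKink x w t i).card : ℝ) =
      ∑ r, ENNReal.ofReal (A.indicator (fun _ => (1 : ℝ)) (w r)) := fun w => by
    rw [card_nearKink_eq_sum, ENNReal.ofReal_sum_of_nonneg]
    exact fun r _ => Set.indicator_nonneg (fun _ _ => zero_le_one) _
  simp_rw [hsum]
  rw [lintegral_finsetSum (f := fun (r : Fin m) (w : Weights m d) =>
    ENNReal.ofReal (A.indicator (fun _ => (1 : ℝ)) (w r))) _
    fun r _ => hmeas.comp (measurable_pi_apply r)]
  have hone : ∫⁻ z, ENNReal.ofReal (A.indicator (fun _ => (1 : ℝ)) z) ∂(weightLaw d ν) ≤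
      ENNReal.ofReal (t / ν) := by
    have : (fun z => ENNReal.ofReal (A.indicator (fun _ => (1 : ℝ)) z)) =
        A.indicator (fun _ => (1 : ENNReal)) := by
      ext z
      by_cases hz : z ∈ A <;> simp [hz]
    rw [this, lintegral_indicator_const hAm, one_mul]
    exact weightLaw_abs_inner_le hν (hx i)
  simp_rw [lintegral_comp_eval_pi (weightLaw d ν) hmeas]
  rw [Finset.sum_const, Finset.card_univ, Fintype.card_fin, nsmul_eq_mul,
    ENNReal.ofReal_mul (Nat.cast_nonneg m), ENNReal.ofReal_natCast]
  gcongr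

/-! ### Good initializations and their probability -/

lemma measure_lt_le_of_lintegral_le {Ω : Type*} [MeasurableSpace Ω] {μ : Measure Ω} {f : Ω → ℝ}
    (hf : Measurable f) {c s p : ℝ} (hs : 0 < s)
    (hint : ∫⁻ ω, ENNReal.ofReal (f ω) ∂μ ≤ ENNReal.ofReal c) (hc : c ≤ s * p) :
    μ {ω | s < f ω} ≤ ENNReal.ofReal p := by
  have h0 : ENNReal.ofReal s ≠ 0 := by simpa using hs
  calc μ {ω | s < f ω} ≤ μ {ω | ENNReal.ofReal s ≤ ENNReal.ofReal (f ω)} :=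
        measure_mono fun ω (hω : s < f ω) => ENNReal.ofReal_le_ofReal hω.le
    _ ≤ (∫⁻ ω, ENNReal.ofReal (f ω) ∂μ) / ENNReal.ofReal s :=
        meas_ge_le_lintegral_div hf.ennreal_ofReal.aemeasurable h0 ENNReal.ofReal_ne_top
    _ ≤ ENNReal.ofReal (s * p) / ENNReal.ofReal s := by
        gcongr
        exact hint.trans (ENNReal.ofReal_le_ofReal hc)
    _ = ENNReal.ofReal p := by
        rw [ENNReal.ofReal_mul hs.le, mul_comm]
        exact ENNReal.mul_div_cancel_right h0 ENNReal.ofReal_ne_top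

lemma lintegral_sum_ofReal_le {ι Ω : Type*} [Fintype ι] [MeasurableSpace Ω] {μ : Measure Ω}
    {f : ι → Ω → ℝ} (hf : ∀ i, Measurable (f i)) (hf0 : ∀ i ω, 0 ≤ f i ω) {c : ℝ}
    (h : ∀ i, ∫⁻ ω, ENNReal.ofReal (f i ω) ∂μ ≤ ENNReal.ofReal c) :
    ∫⁻ ω, ENNReal.ofReal (∑ i, f i ω) ∂μ ≤ ENNReal.ofReal (Fintype.card ι * c) := by
  simp_rw [ENNReal.ofReal_sum_of_nonneg fun i (_ : i ∈ Finset.univ) => hf0 i _]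
  rw [lintegral_finsetSum _ fun i _ => (hf i).ennreal_ofReal]
  refine (Finset.sum_le_sum fun i _ => h i).trans ?_
  rw [Finset.sum_const, Finset.card_univ, nsmul_eq_mul, ENNReal.ofReal_mul (Nat.cast_nonneg _),
    ENNReal.ofReal_natCast]

/-- The quadratic forms of two matrices differ by at most their Frobenius distance. -/
lemma abs_dotProduct_sub_mulVec_le {n : ℕ} (A : Matrix (Fin n) (Fin n) ℝ) {s : ℝ} (hs : 0 ≤ s)
    (hA : ∑ i, ∑ j, A i j ^ 2 ≤ s ^ 2) (v : Fin n → ℝ) :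
    |v ⬝ᵥ A *ᵥ v| ≤ s * ‖WithLp.toLp 2 v‖ ^ 2 := by
  have h1 : ‖WithLp.toLp 2 (A *ᵥ v)‖ ≤ s * ‖WithLp.toLp 2 v‖ := by
    refine (sq_le_sq₀ (norm_nonneg _) (by positivity)).1 ?_
    rw [mul_pow]
    have h := norm_transpose_mulVec_sq_le Aᵀ v
    rw [Matrix.transpose_transpose, Finset.sum_comm] at h
    simp only [Matrix.transpose_apply] at h
    exact h.trans (by gcongr)
  have h2 := abs_real_inner_le_norm (WithLp.toLp 2 (A *ᵥ v)) (WithLp.toLp 2 v)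
  rw [EuclideanSpace.inner_toLp_toLp, star_trivial] at h2
  calc |v ⬝ᵥ A *ᵥ v| ≤ ‖WithLp.toLp 2 (A *ᵥ v)‖ * ‖WithLp.toLp 2 v‖ := h2
    _ ≤ s * ‖WithLp.toLp 2 v‖ * ‖WithLp.toLp 2 v‖ := by gcongr
    _ = s * ‖WithLp.toLp 2 v‖ ^ 2 := by ring

/-- Natural gradient descent converges from every initialization whose outputs are bounded, whose
Gram matrix is close to its limit, and which has few hidden units near a kink. -/
lemma ngdIterate_converges_of_good_init {n m d : ℕ} {x : Fin n → EuclideanSpace ℝ (Fin d)}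
    (hn : 0 < n) (hx : ∀ i, ‖x i‖ = 1) {B N ν δ η η₀ ε : ℝ} {y : Fin n → ℝ}
    (hy : ∀ i, |y i| ≤ B) (hν : 0 < ν) (hνN : ν ≤ N) (hδ : 0 < δ) (hδ1 : δ < 1)
    (hL : 0 < lambdaZero x ν) (hη : 0 < η) (hη₀ : η ≤ η₀) (hη₁ : η₀ < 1)
    (hε : ε = (1 - η₀) ^ 2 / 512)
    (hm : 384 * (N ^ 2 + B ^ 2) / ε ^ 3 * ((n : ℝ) ^ 4 / (ν ^ 2 * lambdaZero x ν ^ 4 * δ ^ 3)) ≤ m)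
    {a : Fin m → ℝ} (ha : ∀ r, |a r| = 1) {w₀ : Weights m d}
    (hout : ∑ i, outputs x a w₀ i ^ 2 ≤ 3 * n * ν ^ 2 / δ)
    (hgram : ∑ i, ∑ j, ((∑ r, unitGram x i j (w₀ r)) / m - limitGram x ν i j) ^ 2 ≤
      (lambdaZero x ν / 2) ^ 2)
    (hkink : ∑ i, ((nearKink x w₀ (ε * lambdaZero x ν * ν * δ / n) i).card : ℝ) ≤
      3 * ε * lambdaZero x ν * m) (k : ℕ) :
    IsUnit (gram x a (ngdIterate x y η a w₀ k)) ∧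
    ‖WithLp.toLp 2 (outputs x a (ngdIterate x y η a w₀ k) - y)‖ ^ 2 ≤
      (1 - η) ^ k * ‖WithLp.toLp 2 (outputs x a w₀ - y)‖ ^ 2 := by
  set L := lambdaZero x ν with hLdef
  have hn' : (0 : ℝ) < n := by exact_mod_cast hn
  have hε0 : 0 < ε := by
    rw [hε]
    have : 0 < 1 - η₀ := by linarith
    positivity
  have hres : ‖WithLp.toLp 2 (outputs x a w₀ - y)‖ ^ 2 ≤ 6 * (N ^ 2 + B ^ 2) * n / δ := by
    have hysum : ∑ i, y i ^ 2 ≤ n * B ^ 2 := by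
      have : ∀ i ∈ Finset.univ, y i ^ 2 ≤ B ^ 2 := fun i _ => by
        rw [← sq_abs]
        exact pow_le_pow_left₀ (abs_nonneg _) (hy i) 2
      simpa using Finset.sum_le_card_nsmul _ _ _ this
    have hu : 3 * n * ν ^ 2 / δ ≤ 3 * n * N ^ 2 / δ := by gcongr
    have hB : n * B ^ 2 ≤ n * B ^ 2 / δ := le_div_self (by positivity) hδ hδ1.le
    calc ‖WithLp.toLp 2 (outputs x a w₀ - y)‖ ^ 2
        = ∑ i, (outputs x a w₀ i - y i) ^ 2 := by rw [EuclideanSpace.real_norm_sq_eq]; rfl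
      _ ≤ ∑ i, (2 * outputs x a w₀ i ^ 2 + 2 * y i ^ 2) :=
          Finset.sum_le_sum fun i _ => by nlinarith [sq_nonneg (outputs x a w₀ i + y i)]
      _ = 2 * ∑ i, outputs x a w₀ i ^ 2 + 2 * ∑ i, y i ^ 2 := by
          rw [Finset.sum_add_distrib, Finset.mul_sum, Finset.mul_sum]
      _ ≤ 2 * (3 * n * N ^ 2 / δ) + 2 * (n * B ^ 2 / δ) := by linarith
      _ ≤ 2 * (3 * n * N ^ 2 / δ) + 6 * (n * B ^ 2 / δ) := by
          gcongr
          norm_num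
      _ = 6 * (N ^ 2 + B ^ 2) * n / δ := by ring
  refine ngdIterate_converges hx ha y hL hη hη₀ hη₁ (fun v => ?_) le_rfl (fun w hw => ?_) k
  · rw [← dotProduct_gram_mulVec]
    have h1 := abs_dotProduct_sub_mulVec_le (gram x a w₀ - limitGram x ν) (s := L / 2)
      (by positivity) (by simpa only [Matrix.sub_apply, gram_apply x ha] using hgram) v
    have h2 := lambdaMin_mul_le (limitGram_isHermitian x ν) v
    rw [← norm_toLp_sq] at h2
    rw [Matrix.sub_mulVec, dotProduct_sub] at h1
    have h3 := (abs_le.1 h1).1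
    change L * _ ≤ _ at h2
    linarith
  · rw [← hε]
    set t := ε * L * ν * δ / n with ht
    have ht0 : 0 < t := by positivity
    have hw2 : ‖flat w - flat w₀‖ ^ 2 ≤ 384 * (N ^ 2 + B ^ 2) * n / (δ * L) := by
      calc ‖flat w - flat w₀‖ ^ 2
          ≤ (8 * ‖WithLp.toLp 2 (outputs x a w₀ - y)‖ / √L) ^ 2 := by gcongr
        _ = 64 / L * ‖WithLp.toLp 2 (outputs x a w₀ - y)‖ ^ 2 := by
            rw [div_pow, mul_pow, Real.sq_sqrt hL.le]; ring
        _ ≤ 64 / L * (6 * (N ^ 2 + B ^ 2) * n / δ) := by gcongr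
        _ = 384 * (N ^ 2 + B ^ 2) * n / (δ * L) := by field_simp; ring
    have hfar : n * (‖flat w - flat w₀‖ ^ 2 / t ^ 2) ≤ ε * L * m := by
      calc n * (‖flat w - flat w₀‖ ^ 2 / t ^ 2)
          ≤ n * (384 * (N ^ 2 + B ^ 2) * n / (δ * L) / t ^ 2) := by gcongr
        _ = ε * L * (384 * (N ^ 2 + B ^ 2) / ε ^ 3 * ((n : ℝ) ^ 4 / (ν ^ 2 * L ^ 4 * δ ^ 3))) := by
            rw [ht]; field_simp
        _ ≤ ε * L * m := by gcongr
    calc ∑ i, ((flips x w₀ w i).card : ℝ)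
        ≤ ∑ i, (‖flat w - flat w₀‖ ^ 2 / t ^ 2 + (nearKink x w₀ t i).card) :=
          Finset.sum_le_sum fun i _ => card_flips_le hx w₀ w ht0 i
      _ = n * (‖flat w - flat w₀‖ ^ 2 / t ^ 2) + ∑ i, ((nearKink x w₀ t i).card : ℝ) := by
          rw [Finset.sum_add_distrib]; simp
      _ ≤ 4 * ε * L * m := by linarith

lemma measure_outputs_large_le {n m d : ℕ} (hn : 0 < n) {x : Fin n → EuclideanSpace ℝ (Fin d)}
    (hx : ∀ i, ‖x i‖ = 1) {ν δ : ℝ} (hν : 0 < ν) (hδ : 0 < δ) :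
    initLaw m d ν {ω | 3 * n * ν ^ 2 / δ < ∑ i, outputs x ω.2 ω.1 i ^ 2} ≤
      ENNReal.ofReal (δ / 3) := by
  have hn' : (0 : ℝ) < n := by exact_mod_cast hn
  refine measure_lt_le_of_lintegral_le (c := n * ν ^ 2)
    (Finset.measurable_sum _ fun i _ => (measurable_outputs x i).pow_const 2) (by positivity)
    ?_ (by field_simp; exact le_rfl)
  simpa using lintegral_sum_ofReal_le (fun i => (measurable_outputs x i).pow_const 2)
    (fun i ω => sq_nonneg _) (lintegral_outputs_sq_le (m := m) hx ν)

lemma measure_gram_far_le {n m d : ℕ} {x : Fin n → EuclideanSpace ℝ (Fin d)}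
    (hx : ∀ i, ‖x i‖ = 1) {ν δ L : ℝ} (hδ : 0 < δ) (hL : 0 < L) (hm0 : 0 < m)
    (hm : 12 * (n : ℝ) ^ 2 / (L ^ 2 * δ) ≤ m) :
    initLaw m d ν {ω | (L / 2) ^ 2 <
      ∑ i, ∑ j, ((∑ r, unitGram x i j (ω.1 r)) / m - limitGram x ν i j) ^ 2} ≤
      ENNReal.ofReal (δ / 3) := by
  have hm' : (0 : ℝ) < m := by exact_mod_cast hm0
  have hmeas : ∀ i j, Measurable fun w : Weights m d =>
      ((∑ r, unitGram x i j (w r)) / m - limitGram x ν i j) ^ 2 := fun i j => by fun_prop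
  have hmeas' : ∀ i, Measurable fun w : Weights m d =>
      ∑ j, ((∑ r, unitGram x i j (w r)) / m - limitGram x ν i j) ^ 2 := fun i =>
    Finset.measurable_sum _ fun j _ => hmeas i j
  have hsum : Measurable fun w : Weights m d =>
      ∑ i, ∑ j, ((∑ r, unitGram x i j (w r)) / m - limitGram x ν i j) ^ 2 :=
    Finset.measurable_sum _ fun i _ => hmeas' i
  refine measure_lt_le_of_lintegral_le (c := n * (n * (1 / m))) (hsum.comp measurable_fst)
    (by positivity) ?_ ?_
  · refine (lintegral_fst_initLaw hsum.ennreal_ofReal).trans_le ?_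
    have hrow := fun i => lintegral_sum_ofReal_le (hmeas i) (fun j w => sq_nonneg _)
      (lintegral_unitGram_average_sq_le hx ν hm0 i)
    have := lintegral_sum_ofReal_le hmeas'
      (fun i w => Finset.sum_nonneg fun j _ => sq_nonneg _) hrow
    simpa only [Fintype.card_fin] using this
  · rw [div_le_iff₀ (by positivity)] at hm
    have : n * (n * (1 / (m : ℝ))) = (n : ℝ) ^ 2 / m := by ring
    rw [this, div_le_iff₀ hm']
    linarith

lemma measure_nearKink_large_le {n m d : ℕ} (hn : 0 < n) (hm : 0 < m)
    {x : Fin n → EuclideanSpace ℝ (Fin d)}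
    (hx : ∀ i, ‖x i‖ = 1) {ν δ s : ℝ} (hν : 0 < ν) (hδ : 0 < δ) (hs : 0 < s) :
    initLaw m d ν {ω | 3 * s * m < ∑ i, ((nearKink x ω.1 (s * ν * δ / n) i).card : ℝ)} ≤
      ENNReal.ofReal (δ / 3) := by
  have hn' : (0 : ℝ) < n := by exact_mod_cast hn
  have hm' : (0 : ℝ) < m := by exact_mod_cast hm
  have hsum : Measurable fun w : Weights m d =>
      ∑ i, ((nearKink x w (s * ν * δ / n) i).card : ℝ) :=
    Finset.measurable_sum _ fun i _ => measurable_card_nearKink x _ i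
  refine measure_lt_le_of_lintegral_le (c := n * (m * (s * ν * δ / n / ν)))
    (hsum.comp measurable_fst) (by positivity) ?_ ?_
  · refine (lintegral_fst_initLaw hsum.ennreal_ofReal).trans_le ?_
    simpa only [Fintype.card_fin] using lintegral_sum_ofReal_le
      (fun i => measurable_card_nearKink x _ i) (fun i w => Nat.cast_nonneg _)
      (lintegral_card_nearKink_le hx hν)
  · field_simp
    exact le_rfl

end NGD

theorem mainTheorem1 (B N η₀ : ℝ) (hη₀ : 0 < η₀) (hη₀_lt : η₀ < 1) :
    ∃ K : ℝ, 0 < K ∧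
      ∀ (n d : ℕ) (x : Fin n → EuclideanSpace ℝ (Fin d)) (y : Fin n → ℝ) (ν δ : ℝ),
        0 < n →
        (∀ i, ‖x i‖ = 1) →
        (∀ i, |y i| ≤ B) →
        (∀ i j, i ≠ j → LinearIndependent ℝ ![x i, x j]) →
        0 < ν → ν ≤ N →
        0 < δ → δ < 1 →
        0 < NGD.lambdaZero x ν ∧
        ∀ (m : ℕ) (η : ℝ),
          K * ((n : ℝ) ^ 4 / (ν ^ 2 * NGD.lambdaZero x ν ^ 4 * δ ^ 3)) ≤ (m : ℝ) →
          0 < η → η ≤ η₀ →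
          ENNReal.ofReal (1 - δ) ≤
            NGD.initLaw m d ν
              {ω | ∀ k : ℕ,
                IsUnit (NGD.gram x ω.2 (NGD.ngdIterate x y η ω.2 ω.1 k)) ∧
                ‖WithLp.toLp 2 (NGD.outputs x ω.2 (NGD.ngdIterate x y η ω.2 ω.1 k) - y)‖ ^ 2 ≤
                  (1 - η) ^ k * ‖WithLp.toLp 2 (NGD.outputs x ω.2 ω.1 - y)‖ ^ 2} := by
  obtain ⟨ε, hε⟩ : ∃ ε : ℝ, ε = (1 - η₀) ^ 2 / 512 := ⟨_, rfl⟩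
  have hε0 : 0 < ε := by
    rw [hε]
    have : 0 < 1 - η₀ := by linarith
    positivity
  -- the first summand bounds the flips, the second the deviation of the Gram matrix from its limit;
  -- the third makes the constant positive
  refine ⟨384 * (N ^ 2 + B ^ 2) / ε ^ 3 + 12 * N ^ 2 + 1, by positivity, ?_⟩
  intro n d x y ν δ hn hx hy hli hν hνN hδ hδ1
  have hL := NGD.lambdaZero_pos hn hx hli hν
  have hL1 := NGD.lambdaZero_le_one hn hx ν
  refine ⟨hL, fun m η hm hη hηη₀ => ?_⟩
  set L := NGD.lambdaZero x ν with hLdef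
  have hn' : (0 : ℝ) < n := by exact_mod_cast hn
  have hn1 : (1 : ℝ) ≤ n := by exact_mod_cast hn
  set D : ℝ := (n : ℝ) ^ 4 / (ν ^ 2 * L ^ 4 * δ ^ 3) with hD
  have hD0 : 0 < D := by positivity
  have hm1 : 384 * (N ^ 2 + B ^ 2) / ε ^ 3 * D ≤ m :=
    le_trans (mul_le_mul_of_nonneg_right (by nlinarith [sq_nonneg N]) hD0.le) hm
  have hm2 : 12 * (n : ℝ) ^ 2 / (L ^ 2 * δ) ≤ m := by
    have h1 : (n : ℝ) ^ 2 / (L ^ 2 * δ) ≤ N ^ 2 * D := by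
      calc (n : ℝ) ^ 2 / (L ^ 2 * δ) ≤ (n : ℝ) ^ 4 / (L ^ 4 * δ ^ 3) := by
            have e1 : (n : ℝ) ^ 2 ≤ (n : ℝ) ^ 4 := pow_le_pow_right₀ hn1 (by norm_num)
            have e2 : L ^ 4 ≤ L ^ 2 := pow_le_pow_of_le_one hL.le hL1 (by norm_num)
            have e3 : δ ^ 3 ≤ δ := by
              simpa using pow_le_pow_of_le_one hδ.le hδ1.le (show 1 ≤ 3 by norm_num)
            gcongr
        _ = ν ^ 2 * D := by rw [hD]; field_simp
        _ ≤ N ^ 2 * D := by gcongr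
    calc 12 * (n : ℝ) ^ 2 / (L ^ 2 * δ) = 12 * ((n : ℝ) ^ 2 / (L ^ 2 * δ)) := by ring
      _ ≤ 12 * (N ^ 2 * D) := by gcongr
      _ = 12 * N ^ 2 * D := by ring
      _ ≤ _ := by
        refine le_trans (mul_le_mul_of_nonneg_right ?_ hD0.le) hm
        have : 0 ≤ 384 * (N ^ 2 + B ^ 2) / ε ^ 3 := by positivity
        linarith
  have hm0 : 0 < m := by
    have h1 : (0 : ℝ) < m := lt_of_lt_of_le (by positivity) hm
    exact_mod_cast h1
  set good : Set (NGD.Weights m d × (Fin m → ℝ)) := {ω | ∀ k : ℕ,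
    IsUnit (NGD.gram x ω.2 (NGD.ngdIterate x y η ω.2 ω.1 k)) ∧
    ‖WithLp.toLp 2 (NGD.outputs x ω.2 (NGD.ngdIterate x y η ω.2 ω.1 k) - y)‖ ^ 2 ≤
      (1 - η) ^ k * ‖WithLp.toLp 2 (NGD.outputs x ω.2 ω.1 - y)‖ ^ 2} with hgood
  set E₀ : Set (NGD.Weights m d × (Fin m → ℝ)) := {ω | ¬ ∀ r, |ω.2 r| = 1}
  set E₁ : Set (NGD.Weights m d × (Fin m → ℝ)) :=
    {ω | 3 * n * ν ^ 2 / δ < ∑ i, NGD.outputs x ω.2 ω.1 i ^ 2}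
  set E₂ : Set (NGD.Weights m d × (Fin m → ℝ)) := {ω | (L / 2) ^ 2 <
    ∑ i, ∑ j, ((∑ r, NGD.unitGram x i j (ω.1 r)) / m - NGD.limitGram x ν i j) ^ 2}
  set E₃ : Set (NGD.Weights m d × (Fin m → ℝ)) := {ω | 3 * (ε * L) * m <
    ∑ i, ((NGD.nearKink x ω.1 (ε * L * ν * δ / n) i).card : ℝ)}
  have hcover : (Set.univ : Set (NGD.Weights m d × (Fin m → ℝ))) ⊆
      good ∪ (E₀ ∪ (E₁ ∪ (E₂ ∪ E₃))) := by
    intro ω _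
    by_contra hω
    simp only [Set.mem_union, not_or, E₀, E₁, E₂, E₃, Set.mem_ofPred_eq, not_lt, not_not] at hω
    obtain ⟨hg, h0, h1, h2, h3⟩ := hω
    exact hg fun k => NGD.ngdIterate_converges_of_good_init hn hx hy hν hνN hδ hδ1 hL hη hηη₀
      hη₀_lt hε hm1 h0 h1 h2 (h3.trans_eq (by ring)) k
  have hE₀ : NGD.initLaw m d ν E₀ = 0 := NGD.ae_abs_eq_one_initLaw m d ν
  have hE₁ := NGD.measure_outputs_large_le (m := m) hn hx hν hδ
  have hE₂ := NGD.measure_gram_far_le (d := d) (ν := ν) hx hδ hL hm0 hm2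
  have hE₃ := NGD.measure_nearKink_large_le hn hm0 hx hν hδ (mul_pos hε0 hL)
  have htotal : 1 ≤ NGD.initLaw m d ν good + ENNReal.ofReal δ := by
    calc (1 : ENNReal) = NGD.initLaw m d ν Set.univ := measure_univ.symm
      _ ≤ NGD.initLaw m d ν (good ∪ (E₀ ∪ (E₁ ∪ (E₂ ∪ E₃)))) := measure_mono hcover
      _ ≤ NGD.initLaw m d ν good + (NGD.initLaw m d ν E₀ + (NGD.initLaw m d ν E₁ +
          (NGD.initLaw m d ν E₂ + NGD.initLaw m d ν E₃))) := by
        refine (measure_union_le _ _).trans (add_le_add le_rfl ?_)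
        refine (measure_union_le _ _).trans (add_le_add le_rfl ?_)
        refine (measure_union_le _ _).trans (add_le_add le_rfl ?_)
        exact measure_union_le _ _
      _ ≤ NGD.initLaw m d ν good + (0 + (ENNReal.ofReal (δ / 3) +
          (ENNReal.ofReal (δ / 3) + ENNReal.ofReal (δ / 3)))) := by
        gcongr
        exact hE₀.le
      _ = NGD.initLaw m d ν good + ENNReal.ofReal δ := by
        rw [zero_add, ← ENNReal.ofReal_add, ← ENNReal.ofReal_add] <;> try positivity
        congr 2
        ring
  rw [ENNReal.ofReal_sub _ hδ.le, ENNReal.ofReal_one]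
  exact tsub_le_iff_right.2 htotal
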